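/- Let $X$ be a complex Banach space and let $1<p<\infty$. Write $\mathbb D=\{a\in\mathbb C:|a|\le 1\}$ and identify $\mathbb R^2$ with $\mathbb C$. Let $\beta^{\mathbb D}_{p,X}\in[0,\infty]$ be the least $\beta$ such that $$\Bigl(\mathbb E\Bigl\|\sum_{n=1}^N\varepsilon_n d_n\Bigr\|^p\Bigr)^{1/p}\le\beta\,\Bigl(\mathbb E\Bigl\|\sum_{n=1}^N d_n\Bigr\|^p\Bigr)^{1/p}$$ for every $N\ge 1$, every $X$-valued $L^p$-martingale difference sequence $(d_n)_{n=1}^N$ on any probability space (that is, $d_1=f_1$ and $d_n=f_n-f_{n-1}$ for $n\ge 2$, for some $L^p$-martingale $(f_n)_{n=1}^N$) and all scalars $\varepsilon_1,\dots,\varepsilon_N\in\mathbb D$. Let $\mathcal S(\mathbb R^2)\otimes X$ be the space of finite sums $\sum_k\varphi_k x_k$ with Schwartz functions $\varphi_k:\mathbb R^2\to\mathbb C$ and $x_k\in X$, and for $f$ in this space let $$(\mathcal{BA}f)(z)=-\frac1\pi\,\lim_{\varepsilon\downarrow 0}\int_{|z-w|>\varepsilon}\frac{f(w)}{(z-w)^2}\,dw,\qquad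 z\in\mathbb C,$$ be its Beurling–Ahlfors transform. Let $\|\mathcal{BA}\|_{\mathcal L(L^p(\mathbb R^2;X))}\in[0,\infty]$ be the least $C$ such that $\|\mathcal{BA}f\|_{L^p(\mathbb R^2;X)}\le C\|f\|_{L^p(\mathbb R^2;X)}$ for all $f\in\mathcal S(\mathbb R^2)\otimes X$ (so it is $\infty$ if $\mathcal{BA}$ does not extend to a bounded operator on $L^p(\mathbb R^2;X)$). Then $$\|\mathcal{BA}\|_{\mathcal L(L^p(\mathbb R^2;X))}\ge\beta^{\mathbb D}_{p,X}.$$ -/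

import Mathlib

open MeasureTheory Filter Topology
open scoped ENNReal SchwartzMap

universe u v

/-! ### The constant `β^A_{p,X}` -/

/-- `d 0, d 1, d 2, …` is an `L^p`-integrable martingale difference sequence: every term lies in
`L^p(Ω; X)` and the partial sums form a martingale for the filtration `ℱ`. -/
structure IsLpMartingaleDifference {Ω : Type v} {mΩ : MeasurableSpace Ω}
    {X : Type u} [NormedAddCommGroup X] [NormedSpace ℂ X] [CompleteSpace X]
    (p : ℝ≥0∞) (μ : Measure Ω) (ℱ : Filtration ℕ mΩ) (d : ℕ → Ω → X) : Prop where
  memLp : ∀ n, MemLp (d n) p μ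
  martingale : Martingale (fun n ω => ∑ k ∈ Finset.range (n + 1), d k ω) ℱ μ

/-- The UMD constant `β^A_{p,X} ∈ [0, ∞]` for a set `A` of complex scalars: the least `β` with
`‖∑_{n<N} ε_n d_n‖_{L^p} ≤ β ‖∑_{n<N} d_n‖_{L^p}` for all probability spaces, all `X`-valued
`L^p`-martingale difference sequences, all `N` and all scalars `ε_n ∈ A`.
(A finite difference sequence is an infinite one that is continued by zeros.) -/
noncomputable def umdConst (A : Set ℂ) (p : ℝ≥0∞)
    (X : Type u) [NormedAddCommGroup X] [NormedSpace ℂ X] [CompleteSpace X] : ℝ≥0∞ :=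
  sInf {β : ℝ≥0∞ | ∀ (Ω : Type v) (mΩ : MeasurableSpace Ω) (μ : Measure Ω) (_ : IsProbabilityMeasure μ)
    (ℱ : Filtration ℕ mΩ) (d : ℕ → Ω → X) (ε : ℕ → ℂ) (N : ℕ),
    IsLpMartingaleDifference p μ ℱ d → (∀ n, ε n ∈ A) →
      eLpNorm (fun ω => ∑ n ∈ Finset.range N, ε n • d n ω) p μ
        ≤ β * eLpNorm (fun ω => ∑ n ∈ Finset.range N, d n ω) p μ}

/-! ### The Beurling–Ahlfors transform -/

/-- The algebraic tensor product `𝓢(ℝ²) ⊗ X`, as a set of functions on `ℂ ≃ ℝ²`: the functions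
`∑_k φ_k x_k` with finitely many Schwartz functions `φ_k` and vectors `x_k ∈ X`. -/
def IsSchwartzTensor {X : Type u} [NormedAddCommGroup X] [NormedSpace ℂ X] (f : ℂ → X) : Prop :=
  ∃ (K : ℕ) (φ : Fin K → 𝓢(ℂ, ℂ)) (x : Fin K → X), f = fun z => ∑ k, φ k z • x k

/-- The truncated singular integral `-(1/π) ∫_{|z - w| > ε} f(w) / (z - w)² dw`. -/
noncomputable def truncatedBeurlingAhlfors {X : Type u} [NormedAddCommGroup X] [NormedSpace ℂ X]
    (ε : ℝ) (f : ℂ → X) (z : ℂ) : X :=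
  (-(Real.pi : ℂ)⁻¹) • ∫ w in {w : ℂ | ε < ‖z - w‖}, ((z - w) ^ 2)⁻¹ • f w

/-- The Beurling–Ahlfors transform `-(1/π) p.v. ∫ f(w) / (z - w)² dw`. The limit exists at every
point for every `f ∈ 𝓢(ℝ²) ⊗ X`, see `IsSchwartzTensor.tendsto_beurlingAhlfors`. -/
noncomputable def beurlingAhlfors {X : Type u} [NormedAddCommGroup X] [NormedSpace ℂ X]
    (f : ℂ → X) (z : ℂ) : X :=
  limUnder (𝓝[>] (0 : ℝ)) (fun ε => truncatedBeurlingAhlfors ε f z)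

/-- The norm `‖BA‖_{L(L^p(ℝ²; X))} ∈ [0, ∞]`, that is, the least `C` such that
`‖BA f‖_p ≤ C ‖f‖_p` on the dense subspace `𝓢(ℝ²) ⊗ X`; it is `∞` exactly when `BA` has no
extension to a bounded operator on `L^p(ℝ²; X)`. -/
noncomputable def beurlingAhlforsNorm (p : ℝ≥0∞)
    (X : Type u) [NormedAddCommGroup X] [NormedSpace ℂ X] : ℝ≥0∞ :=
  sInf {C : ℝ≥0∞ | ∀ f : ℂ → X, IsSchwartzTensor f →
    eLpNorm (beurlingAhlfors f) p volume ≤ C * eLpNorm f p volume}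

/-! ### The principal value exists on `𝓢(ℝ²) ⊗ X` -/

/-- The kernel has mean zero over annuli, by the rotation `u ↦ i u`. -/
theorem setIntegral_annulus_inv_sq (ε : ℝ) (z : ℂ) :
    ∫ w in {w : ℂ | ε < ‖z - w‖ ∧ ‖z - w‖ < 1}, ((z - w) ^ 2)⁻¹ = 0 := by
  let g : ℂ → ℂ := {u : ℂ | ε < ‖u‖ ∧ ‖u‖ < 1}.indicator (fun u => (u ^ 2)⁻¹)
  have hm : MeasurableSet {w : ℂ | ε < ‖z - w‖ ∧ ‖z - w‖ < 1} :=
    (measurableSet_lt (f := fun _ : ℂ => ε) (g := fun w => ‖z - w‖) (by fun_prop)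
      (by fun_prop)).inter (measurableSet_lt (f := fun w : ℂ => ‖z - w‖) (g := fun _ => 1)
        (by fun_prop) (by fun_prop))
  have h1 : ∫ w in {w : ℂ | ε < ‖z - w‖ ∧ ‖z - w‖ < 1}, ((z - w) ^ 2)⁻¹ = ∫ w, g (z - w) := by
    rw [← integral_indicator hm]
    rfl
  have h2 : ∫ w, g (z - w) = ∫ u, g u := integral_sub_left_eq_self g volume z
  have h3 : ∃ r : ℂ ≃ₗᵢ[ℝ] ℂ, ∀ u, r u = Complex.I * u := by
    refine ⟨rotation (Circle.exp (Real.pi / 2)), fun u => ?_⟩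
    rw [rotation_apply, Circle.coe_exp]
    push_cast
    rw [Complex.exp_pi_div_two_mul_I]
  obtain ⟨r, hr⟩ := h3
  have h4 : ∫ u, g (r u) = ∫ u, g u :=
    r.measurePreserving.integral_comp r.toHomeomorph.measurableEmbedding g
  have h5 : ∀ u, g (r u) = - g u := by
    intro u
    have hn : ‖r u‖ = ‖u‖ := r.norm_map u
    by_cases hu : ε < ‖u‖ ∧ ‖u‖ < 1
    · have hu' : ε < ‖r u‖ ∧ ‖r u‖ < 1 := by rwa [hn]
      simp only [g]
      rw [Set.indicator_of_mem (s := {u : ℂ | ε < ‖u‖ ∧ ‖u‖ < 1}) hu',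
        Set.indicator_of_mem (s := {u : ℂ | ε < ‖u‖ ∧ ‖u‖ < 1}) hu, hr, mul_pow, Complex.I_sq]
      simp
    · have hu' : ¬ (ε < ‖r u‖ ∧ ‖r u‖ < 1) := by rwa [hn]
      simp only [g]
      rw [Set.indicator_of_notMem (s := {u : ℂ | ε < ‖u‖ ∧ ‖u‖ < 1}) hu',
        Set.indicator_of_notMem (s := {u : ℂ | ε < ‖u‖ ∧ ‖u‖ < 1}) hu, neg_zero]
  simp only [h5, integral_neg] at h4
  rw [h1, h2]
  exact self_eq_neg.mp h4.symm

theorem tendsto_truncatedBeurlingAhlfors {X : Type u} [NormedAddCommGroup X] [NormedSpace ℂ X]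
    {f : ℂ → X} (hf : Integrable f) {z : ℂ} {C : ℝ}
    (hC : ∀ w, ‖f w - f z‖ ≤ C * ‖w - z‖) :
    ∃ y : X, Tendsto (fun ε => truncatedBeurlingAhlfors ε f z) (𝓝[>] (0 : ℝ)) (𝓝 y) := by
  let h : ℂ → X := (Metric.ball z 1).indicator (fun _ => f z)
  let F : ℂ → X := fun w => ((z - w) ^ 2)⁻¹ • (f w - h w)
  have hh : Integrable h :=
    (integrable_indicator_iff measurableSet_ball).2
      (integrableOn_const measure_ball_lt_top.ne)
  have hk : Measurable (fun w : ℂ => ((z - w) ^ 2)⁻¹) := by fun_prop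
  have hFm : AEStronglyMeasurable F :=
    hk.aestronglyMeasurable.smul (hf.sub hh).aestronglyMeasurable
  -- integrability near the singularity
  have hF1 : IntegrableOn F (Metric.ball z 1) := by
    have hb : IntegrableOn (fun w : ℂ => C * ‖w‖ ^ (-1 : ℝ)) (Metric.ball 0 1) := by
      refine integrableOn_ball_of_norm_le_rpow (α := 1) (C := |C|) (by simp) (by simp) ?_ ?_
      · refine Eventually.of_forall fun x => ?_
        rw [norm_mul, Real.norm_eq_abs, Real.norm_of_nonneg (by positivity)]
      · exact Measurable.aestronglyMeasurable (by fun_prop)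
    have hb' : IntegrableOn (fun w : ℂ => C * ‖w - z‖ ^ (-1 : ℝ)) (Metric.ball z 1) := by
      rw [← integrable_indicator_iff measurableSet_ball] at hb ⊢
      refine (hb.comp_sub_right z).congr (Eventually.of_forall fun w => ?_)
      by_cases hw : w ∈ Metric.ball z 1
      · have hw' : w - z ∈ Metric.ball (0 : ℂ) 1 := by simpa [dist_eq_norm] using hw
        simp only [Set.indicator_of_mem hw, Set.indicator_of_mem hw']
      · have hw' : w - z ∉ Metric.ball (0 : ℂ) 1 := by simpa [dist_eq_norm] using hw
        simp only [Set.indicator_of_notMem hw, Set.indicator_of_notMem hw']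
    refine Integrable.mono' hb' hFm.restrict ?_
    refine (ae_restrict_iff' measurableSet_ball).2 (Eventually.of_forall fun w hw => ?_)
    have hhw : h w = f z := Set.indicator_of_mem hw _
    simp only [F, hhw, norm_smul, norm_inv, norm_pow]
    rw [norm_sub_rev z w, Real.rpow_neg_one]
    rcases eq_or_ne w z with rfl | hne
    · simp
    · have hpos : 0 < ‖w - z‖ := norm_pos_iff.2 (sub_ne_zero.2 hne)
      calc (‖w - z‖ ^ 2)⁻¹ * ‖f w - f z‖ ≤ (‖w - z‖ ^ 2)⁻¹ * (C * ‖w - z‖) := by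
            gcongr
            exact hC w
        _ = C * ‖w - z‖⁻¹ := by field_simp
  have hkb : ∀ w, w ∉ Metric.ball z 1 → ‖((z - w) ^ 2)⁻¹‖ ≤ 1 := by
    intro w hw
    have hw' : 1 ≤ ‖z - w‖ := by
      rw [norm_sub_rev]
      simpa [dist_eq_norm] using hw
    rw [norm_inv, norm_pow]
    exact inv_le_one_of_one_le₀ (one_le_pow₀ hw')
  have hF2 : IntegrableOn F (Metric.ball z 1)ᶜ := by
    refine Integrable.mono' (hf.sub hh).norm.integrableOn hFm.restrict ?_
    refine (ae_restrict_iff' measurableSet_ball.compl).2 (Eventually.of_forall fun w hw => ?_)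
    simp only [F, norm_smul]
    exact mul_le_of_le_one_left (norm_nonneg _) (hkb w hw)
  have hF : Integrable F := by
    rw [← integrableOn_univ, ← Set.union_compl_self (Metric.ball z 1)]
    exact hF1.union hF2
  have hms : ∀ ε : ℝ, MeasurableSet {w : ℂ | ε < ‖z - w‖} := fun ε =>
    measurableSet_lt measurable_const (by fun_prop)
  -- the truncated integrals of `F`
  have hlim : Tendsto (fun ε : ℝ => ∫ w in {w : ℂ | ε < ‖z - w‖}, F w) (𝓝[>] 0) (𝓝 (∫ w, F w)) := by
    simp_rw [← integral_indicator (hms _)]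
    refine tendsto_integral_filter_of_dominated_convergence (fun w => ‖F w‖) ?_ ?_ hF.norm ?_
    · exact Eventually.of_forall fun ε => hFm.indicator (hms ε)
    · exact Eventually.of_forall fun ε => Eventually.of_forall fun w => norm_indicator_le_norm_self _ _
    · have hz : ∀ᵐ w : ℂ, w ≠ z := by
        simp [ae_iff]
      filter_upwards [hz] with w hw
      have hpos : 0 < ‖z - w‖ := norm_pos_iff.2 (sub_ne_zero.2 hw.symm)
      refine tendsto_const_nhds.congr' ?_
      filter_upwards [Ioo_mem_nhdsGT hpos] with ε hε
      rw [Set.indicator_of_mem (s := {w : ℂ | ε < ‖z - w‖}) hε.2]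
  refine ⟨(-(Real.pi : ℂ)⁻¹) • ∫ w, F w, ?_⟩
  refine (hlim.const_smul (-(Real.pi : ℂ)⁻¹)).congr' ?_
  filter_upwards [Ioo_mem_nhdsGT (zero_lt_one' ℝ)] with ε hε
  unfold truncatedBeurlingAhlfors
  congr 1
  have hkb2 : ∀ w ∈ {w : ℂ | ε < ‖z - w‖}, ‖((z - w) ^ 2)⁻¹‖ ≤ (ε ^ 2)⁻¹ := by
    intro w hw
    rw [norm_inv, norm_pow]
    have h0 := hε.1
    have hw' : ε < ‖z - w‖ := hw
    gcongr
  have hint : ∀ g : ℂ → X, Integrable g →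
      IntegrableOn (fun w => ((z - w) ^ 2)⁻¹ • g w) {w : ℂ | ε < ‖z - w‖} := by
    intro g hg
    refine Integrable.mono' (hg.norm.const_mul (ε ^ 2)⁻¹).integrableOn
      (hk.aestronglyMeasurable.smul hg.aestronglyMeasurable).restrict ?_
    refine (ae_restrict_iff' (hms ε)).2 (Eventually.of_forall fun w hw => ?_)
    rw [norm_smul]
    gcongr
    exact hkb2 w hw
  have hzero : ∫ w in {w : ℂ | ε < ‖z - w‖}, ((z - w) ^ 2)⁻¹ • h w = 0 := by
    have e1 : ∀ w, ((z - w) ^ 2)⁻¹ • h w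
        = (Metric.ball z 1).indicator (fun w => ((z - w) ^ 2)⁻¹ • f z) w := by
      intro w
      by_cases hw : w ∈ Metric.ball z 1
      · simp only [h, Set.indicator_of_mem hw]
      · simp only [h, Set.indicator_of_notMem hw, smul_zero]
    simp_rw [e1]
    rw [setIntegral_indicator measurableSet_ball]
    have e2 : {w : ℂ | ε < ‖z - w‖} ∩ Metric.ball z 1 = {w : ℂ | ε < ‖z - w‖ ∧ ‖z - w‖ < 1} := by
      ext w
      simp [dist_eq_norm, norm_sub_rev z w]
    rw [e2]
    by_cases hX : CompleteSpace X
    · rw [integral_smul_const, setIntegral_annulus_inv_sq, zero_smul]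
    · simp [integral, hX]
  simp only [F, smul_sub]
  rw [integral_sub (hint f hf) (hint h hh), hzero, sub_zero]

theorem IsSchwartzTensor.tendsto_beurlingAhlfors {X : Type u} [NormedAddCommGroup X]
    [NormedSpace ℂ X] {f : ℂ → X} (hf : IsSchwartzTensor f) (z : ℂ) :
    Tendsto (fun ε => truncatedBeurlingAhlfors ε f z) (𝓝[>] (0 : ℝ)) (𝓝 (beurlingAhlfors f z)) := by
  obtain ⟨K, φ, x, rfl⟩ := hf
  have hlip : ∀ k, ∃ C : ℝ, ∀ w, ‖φ k w - φ k z‖ ≤ C * ‖w - z‖ := by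
    intro k
    refine ⟨SchwartzMap.seminorm ℝ 0 1 (φ k), fun w => ?_⟩
    refine Convex.norm_image_sub_le_of_norm_fderiv_le (𝕜 := ℝ) (s := Set.univ)
      (fun y _ => (φ k).differentiableAt) (fun y _ => ?_) convex_univ
      (Set.mem_univ _) (Set.mem_univ _)
    rw [← norm_iteratedFDeriv_one]
    exact SchwartzMap.norm_iteratedFDeriv_le_seminorm ℝ (φ k) 1 y
  choose C hC using hlip
  refine tendsto_nhds_limUnder (tendsto_truncatedBeurlingAhlfors (C := ∑ k, C k * ‖x k‖) ?_ ?_)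
  · exact integrable_finsetSum _ fun k _ => (φ k).integrable.smul_const (x k)
  · intro w
    rw [← Finset.sum_sub_distrib, Finset.sum_mul]
    refine norm_sum_le_of_le _ fun k _ => ?_
    rw [← sub_smul, norm_smul]
    calc ‖φ k w - φ k z‖ * ‖x k‖ ≤ (C k * ‖w - z‖) * ‖x k‖ := by
          gcongr
          exact hC k w
      _ = C k * ‖x k‖ * ‖w - z‖ := by ring

/-! Since BA maps ∂̄g to ∂g (`beurlingAhlfors_wirtingerBar`), a bound C for BA says ‖∂g‖_p ≤
C‖∂̄g‖_p. With Φ(a, b) = ‖b‖^p - C^p‖a‖^p, this says that the mean of Φ(∂̄g, ∂g) is never positive.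
A cutoff on large squares carries the inequality from compactly supported g to doubly periodic g
(`IsPeriodicField.integral_norm_wirtinger_rpow_le`).

Let U(y) be the supremum, over smooth periodic g with finite dimensional range, of the mean of Φ(y +
(∂̄g, ∂g)) over a period, as in the calculus of variations. Then Φ ≤ U and U(0) ≤ 0. A plane wave
g(z) = H(m Re z + n Im z)x' has (∂̄g, ∂g) proportional to (x', εx') with ε = (m - ni)/(m + ni), a
point of the unit circle. Oscillating between two values along such a wave, and inserting much
faster oscillations of g₁ and g₂ on the two phases, gives a laminate. In the high-frequency limit
this shows that U is concave in every direction (x, εx) (`convexComb_fieldEnergy_le`). Because Φ is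
even, so is U, and concavity at the origin gives U(x, εx) ≤ 0 (`exists_concave_majorant`).

Burkholder's argument then applies. If d_k is a simple martingale difference sequence and each ε_k
is such a quotient, the conditional Jensen inequality in the direction (x, ε_k x) makes E U(∑d_k,
∑ε_k d_k) nonincreasing in the number of terms. It starts nonpositive, so E Φ(∑d_k, ∑ε_k d_k) ≤ 0,
which is the transform inequality with constant C (`integral_centered_le_zero`). Approximation in
L^p by simple differences removes simplicity (`IsLpMartingaleDifference.eLpNorm_transform_le`). The
quotients ε are dense in the circle, whose convex hull is the closed disc, and the L^p norm is
convex and continuous in each coefficient, so all multipliers in the disc are covered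
(`eLpNorm_sum_smul_le_of_circleQuotient`). -/

/-! ### Wirtinger derivatives -/

section Wirtinger

variable {X : Type u} [NormedAddCommGroup X] [NormedSpace ℂ X]

/-- The Wirtinger derivative `∂̄` of a function with real derivative `L`. -/
noncomputable def wirtingerBar (L : ℂ →L[ℝ] X) : X := (2⁻¹ : ℂ) • (L 1 + Complex.I • L Complex.I)

/-- The Wirtinger derivative `∂` of a function with real derivative `L`. -/
noncomputable def wirtinger (L : ℂ →L[ℝ] X) : X := (2⁻¹ : ℂ) • (L 1 - Complex.I • L Complex.I)

theorem wirtingerBar_add (L M : ℂ →L[ℝ] X) :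
    wirtingerBar (L + M) = wirtingerBar L + wirtingerBar M := by
  simp only [wirtingerBar, add_apply]
  module

theorem wirtinger_add (L M : ℂ →L[ℝ] X) : wirtinger (L + M) = wirtinger L + wirtinger M := by
  simp only [wirtinger, add_apply]
  module

theorem wirtingerBar_smul (c : ℝ) (L : ℂ →L[ℝ] X) :
    wirtingerBar (c • L) = c • wirtingerBar L := by
  simp only [wirtingerBar, smul_apply, ← Complex.coe_smul]
  module

theorem wirtinger_smul (c : ℝ) (L : ℂ →L[ℝ] X) : wirtinger (c • L) = c • wirtinger L := by
  simp only [wirtinger, smul_apply, ← Complex.coe_smul]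
  module

@[simp] theorem wirtingerBar_zero : wirtingerBar (0 : ℂ →L[ℝ] X) = 0 := by simp [wirtingerBar]

@[simp] theorem wirtinger_zero : wirtinger (0 : ℂ →L[ℝ] X) = 0 := by simp [wirtinger]

theorem continuous_wirtingerBar : Continuous (wirtingerBar : (ℂ →L[ℝ] X) → X) := by
  unfold wirtingerBar
  fun_prop

theorem continuous_wirtinger : Continuous (wirtinger : (ℂ →L[ℝ] X) → X) := by
  unfold wirtinger
  fun_prop

theorem norm_wirtingerBar_le (L : ℂ →L[ℝ] X) : ‖wirtingerBar L‖ ≤ ‖L‖ := by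
  have h1 := L.le_opNorm 1
  have h2 := L.le_opNorm Complex.I
  have h3 := norm_add_le (L 1) (Complex.I • L Complex.I)
  simp only [norm_smul, Complex.norm_I, one_mul, norm_one, mul_one] at h1 h2 h3
  rw [wirtingerBar, norm_smul]
  norm_num
  linarith

theorem apply_eq_re_im (L : ℂ →L[ℝ] X) (w : ℂ) :
    L w = (w.re : ℂ) • L 1 + (w.im : ℂ) • L Complex.I := by
  conv_lhs => rw [← Complex.re_add_im w]
  rw [map_add]
  congr 1
  · rw [show (w.re : ℂ) = w.re • (1 : ℂ) by simp, map_smul, Complex.real_smul, mul_one,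
      Complex.coe_smul]
  · rw [show (w.im : ℂ) * Complex.I = w.im • Complex.I by simp, map_smul, Complex.coe_smul]

end Wirtinger

/-! ### The Beurling–Ahlfors transform maps `∂̄g` to `∂g` -/

section PolarCoordinates

variable {X : Type u} [NormedAddCommGroup X] [NormedSpace ℂ X]

/-- The point `e^{iθ}` of the unit circle in coordinates. -/
noncomputable def unitPoint (θ : ℝ) : ℂ := Real.cos θ + Real.sin θ * Complex.I

/-- The point `e^{-iθ}` of the unit circle in coordinates. -/
noncomputable def unitPointConj (θ : ℝ) : ℂ := Real.cos θ - Real.sin θ * Complex.I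

theorem unitPoint_mul_conj (θ : ℝ) : unitPoint θ * unitPointConj θ = 1 := by
  have h : (Real.cos θ : ℂ) ^ 2 + (Real.sin θ : ℂ) ^ 2 = 1 := by
    exact_mod_cast Real.cos_sq_add_sin_sq θ
  simp only [unitPoint, unitPointConj]
  linear_combination h - (Real.sin θ : ℂ) ^ 2 * Complex.I_sq

theorem norm_unitPoint (θ : ℝ) : ‖unitPoint θ‖ = 1 := by
  simp [unitPoint]

theorem norm_unitPointConj (θ : ℝ) : ‖unitPointConj θ‖ = 1 := by
  have h := congrArg norm (unitPoint_mul_conj θ)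
  rwa [norm_mul, norm_unitPoint, one_mul, norm_one] at h

theorem continuous_unitPoint : Continuous unitPoint := by
  unfold unitPoint
  fun_prop

theorem continuous_unitPointConj : Continuous unitPointConj := by
  unfold unitPointConj
  fun_prop

@[simp] theorem unitPoint_re (θ : ℝ) : (unitPoint θ).re = Real.cos θ := by
  simp only [unitPoint, Complex.add_re, Complex.ofReal_re, Complex.mul_re, Complex.ofReal_im,
    Complex.I_re, Complex.I_im]
  ring

@[simp] theorem unitPoint_im (θ : ℝ) : (unitPoint θ).im = Real.sin θ := by
  simp only [unitPoint, Complex.add_im, Complex.ofReal_re, Complex.mul_im, Complex.ofReal_im,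
    Complex.I_re, Complex.I_im]
  ring

theorem hasDerivAt_unitPoint (θ : ℝ) :
    HasDerivAt unitPoint (Complex.I * unitPoint θ) θ := by
  have h1 := (Real.hasDerivAt_cos θ).ofReal_comp
  have h2 := ((Real.hasDerivAt_sin θ).ofReal_comp).mul_const Complex.I
  refine (h1.fun_add h2).congr_deriv ?_
  rw [Complex.ofReal_neg, unitPoint]
  linear_combination -(Real.sin θ : ℂ) * Complex.I_sq

theorem hasDerivAt_unitPointConj (θ : ℝ) :
    HasDerivAt unitPointConj (-Complex.I * unitPointConj θ) θ := by
  have h1 := (Real.hasDerivAt_cos θ).ofReal_comp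
  have h2 := ((Real.hasDerivAt_sin θ).ofReal_comp).mul_const Complex.I
  refine (h1.fun_sub h2).congr_deriv ?_
  rw [Complex.ofReal_neg, unitPointConj]
  linear_combination -(Real.sin θ : ℂ) * Complex.I_sq

theorem integral_unitPointConj : ∫ θ in (-Real.pi)..Real.pi, unitPointConj θ = 0 := by
  have h : ∀ θ ∈ Set.uIcc (-Real.pi) Real.pi,
      HasDerivAt (fun θ => Complex.I * unitPointConj θ) (unitPointConj θ) θ := by
    intro θ _
    refine ((hasDerivAt_unitPointConj θ).const_mul Complex.I).congr_deriv ?_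
    linear_combination -(unitPointConj θ) * Complex.I_sq
  rw [intervalIntegral.integral_eq_sub_of_hasDerivAt h
    (continuous_unitPointConj.intervalIntegrable _ _)]
  simp [unitPointConj]

/-- Split L into its complex linear part, with coefficient ∂, and its conjugate linear part, with
coefficient ∂̄. Multiplication by e^{-iθ} makes the first constant on the circle and turns the
second into a multiple of e^{-2iθ}, of mean zero. -/
theorem integral_unitPointConj_smul [CompleteSpace X] (L : ℂ →L[ℝ] X) :
    ∫ θ in (-Real.pi)..Real.pi, unitPointConj θ • L (unitPoint θ)
      = (2 * Real.pi : ℂ) • wirtinger L := by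
  -- An explicit antiderivative: θ ± sin θ cos θ has derivative 2cos²θ or 2sin²θ, and sin²θ has
  -- derivative 2 sin θ cos θ.
  let G : ℝ → X := fun θ => (((θ + Real.sin θ * Real.cos θ : ℝ) : ℂ)
      - ((Real.sin θ ^ 2 : ℝ) : ℂ) * Complex.I) • ((2⁻¹ : ℂ) • L 1)
    + (((Real.sin θ ^ 2 : ℝ) : ℂ) - ((θ - Real.sin θ * Real.cos θ : ℝ) : ℂ) * Complex.I)
      • ((2⁻¹ : ℂ) • L Complex.I)
  have h : ∀ θ ∈ Set.uIcc (-Real.pi) Real.pi,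
      HasDerivAt G (unitPointConj θ • L (unitPoint θ)) θ := by
    intro θ _
    have hs := Real.hasDerivAt_sin θ
    have hc := Real.hasDerivAt_cos θ
    have h1 := ((hasDerivAt_id' θ).fun_add (hs.fun_mul hc)).ofReal_comp
    have h2 := ((hs.fun_pow 2).ofReal_comp).mul_const Complex.I
    have h3 := (hs.fun_pow 2).ofReal_comp
    have h4 := (((hasDerivAt_id' θ).fun_sub (hs.fun_mul hc)).ofReal_comp).mul_const Complex.I
    have h5 := ((h1.fun_sub h2).smul_const ((2⁻¹ : ℂ) • L 1)).fun_add
      ((h3.fun_sub h4).smul_const ((2⁻¹ : ℂ) • L Complex.I))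
    refine h5.congr_deriv ?_
    have hsc : (Real.sin θ : ℂ) ^ 2 + (Real.cos θ : ℂ) ^ 2 = 1 := by
      exact_mod_cast Real.sin_sq_add_cos_sq θ
    rw [apply_eq_re_im L (unitPoint θ), unitPoint_re, unitPoint_im, smul_add, smul_smul,
      smul_smul, smul_smul, smul_smul]
    simp only [unitPointConj]
    push_cast at hsc ⊢
    congr 2
    · linear_combination (-1/2) * hsc
    · linear_combination (1/2) * Complex.I * hsc
  rw [intervalIntegral.integral_eq_sub_of_hasDerivAt h]
  · simp only [G, wirtinger]
    simp
    module
  · apply Continuous.intervalIntegrable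
    exact continuous_unitPointConj.smul (L.continuous.comp continuous_unitPoint)

/-- The polar coordinate form of `r e^{iθ}`. -/
theorem polarCoord_symm_eq (q : ℝ × ℝ) :
    Complex.polarCoord.symm q = (q.1 : ℂ) * unitPoint q.2 := by
  rw [Complex.polarCoord_symm_apply]
  rfl

/-- Green's formula off a small disc: w⁻² is holomorphic there, so w⁻²∂̄g is a divergence and only
the circle of radius ε contributes. -/
theorem setIntegral_inv_sq_smul_wirtingerBar [CompleteSpace X] {g : ℂ → X} (hg : ContDiff ℝ 1 g)
    (hs : HasCompactSupport g) {ε : ℝ} (hε : 0 < ε) :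
    ∫ w in {w : ℂ | ε < ‖w‖}, (w ^ 2)⁻¹ • wirtingerBar (fderiv ℝ g w)
      = -(2⁻¹ : ℂ) • ∫ θ in (-Real.pi)..Real.pi,
          ((ε : ℂ)⁻¹ * unitPointConj θ) • g (ε * unitPoint θ) := by
  have hgd : Differentiable ℝ g := hg.differentiable (by simp)
  have hgc : Continuous (fderiv ℝ g) := hg.continuous_fderiv (by simp)
  obtain ⟨R₀, hR₀⟩ := hs.isCompact.isBounded.subset_closedBall (0 : ℂ)
  obtain ⟨R, hRε, hR⟩ : ∃ R, ε ≤ R ∧ R₀ < R := ⟨max ε (R₀ + 1), le_max_left _ _,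
    lt_of_lt_of_le (lt_add_one _) (le_max_right _ _)⟩
  have hout : ∀ w : ℂ, R ≤ ‖w‖ → w ∉ tsupport g := by
    intro w hw hw'
    have := hR₀ hw'
    rw [mem_closedBall_zero_iff] at this
    linarith
  have hg0 : ∀ w : ℂ, R ≤ ‖w‖ → g w = 0 := fun w hw => image_eq_zero_of_notMem_tsupport (hout w hw)
  have hf0 : ∀ w : ℂ, R ≤ ‖w‖ → fderiv ℝ g w = 0 := fun w hw =>
    image_eq_zero_of_notMem_tsupport (fun h => hout w hw (tsupport_fderiv_subset ℝ h))
  have hpos : ∀ r ∈ Set.Icc ε R, (0 : ℝ) < r := fun r hr => hε.trans_le hr.1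
  let P : ℝ → ℝ → ℂ := fun r θ => r * unitPoint θ
  have hPc : Continuous (fun q : ℝ × ℝ => P q.1 q.2) := by
    have := continuous_unitPoint
    fun_prop
  -- `D1` is ∂_r(r⁻¹e^{-iθ}g) and `D2` is ∂_θ(ie^{-iθ}g). In D1 + r⁻²D2 the terms without
  -- derivatives of g cancel.
  let D1 : ℝ → ℝ → X := fun r θ =>
    (-((r : ℂ) ^ 2)⁻¹ * unitPointConj θ) • g (P r θ)
      + ((r : ℂ)⁻¹ * unitPointConj θ) • fderiv ℝ g (P r θ) (unitPoint θ)
  let D2 : ℝ → ℝ → X := fun r θ =>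
    unitPointConj θ • g (P r θ)
      + (Complex.I * unitPointConj θ) • fderiv ℝ g (P r θ) (r * (Complex.I * unitPoint θ))
  -- the integrand in polar coordinates
  have key : ∀ r θ, r ≠ 0 → r • (((P r θ) ^ 2)⁻¹ • wirtingerBar (fderiv ℝ g (P r θ)))
      = (2⁻¹ : ℂ) • (D1 r θ + ((r : ℂ) ^ 2)⁻¹ • D2 r θ) := by
    intro r θ hr
    have hr' : (r : ℂ) ≠ 0 := by exact_mod_cast hr
    have hinv : (unitPoint θ)⁻¹ = unitPointConj θ :=
      inv_eq_of_mul_eq_one_right (unitPoint_mul_conj θ)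
    have e1 : ((P r θ) ^ 2)⁻¹ = ((r : ℂ) ^ 2)⁻¹ * unitPointConj θ ^ 2 := by
      simp only [P]
      rw [mul_pow, mul_inv, ← inv_pow (unitPoint θ), hinv]
    simp only [D1, D2, wirtingerBar, e1]
    generalize fderiv ℝ g (P r θ) = L
    generalize g (P r θ) = y
    have e2 : L (r * (Complex.I * unitPoint θ))
        = (-(r : ℂ) * Real.sin θ) • L 1 + ((r : ℂ) * Real.cos θ) • L Complex.I := by
      rw [apply_eq_re_im L (r * (Complex.I * unitPoint θ))]
      simp
    rw [e2, apply_eq_re_im L (unitPoint θ), unitPoint_re, unitPoint_im, ← Complex.coe_smul]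
    have hc : unitPointConj θ = (Real.cos θ : ℂ) - Real.sin θ * Complex.I := rfl
    simp only [smul_add, smul_smul]
    match_scalars
    · field_simp
      rw [hc]
      push_cast
      ring
    · field_simp
      rw [hc]
      push_cast
      linear_combination (-Complex.cos θ * Complex.sin θ + Complex.sin θ ^ 2 * Complex.I)
        * Complex.I_sq
    · field_simp
      ring
  let T : Set (ℝ × ℝ) := Set.Ioc ε R ×ˢ Set.Ioo (-Real.pi) Real.pi
  have hTm : MeasurableSet T := measurableSet_Ioc.prod measurableSet_Ioo
  have hTsub : T ⊆ Set.Icc ε R ×ˢ Set.Icc (-Real.pi) Real.pi :=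
    Set.prod_mono Set.Ioc_subset_Icc_self Set.Ioo_subset_Icc_self
  have hTc : IsCompact (Set.Icc ε R ×ˢ Set.Icc (-Real.pi) Real.pi) :=
    isCompact_Icc.prod isCompact_Icc
  have hc1 : Continuous (fun q : ℝ × ℝ => unitPointConj q.2) :=
    continuous_unitPointConj.comp continuous_snd
  have hc2 : Continuous (fun q : ℝ × ℝ => unitPoint q.2) :=
    continuous_unitPoint.comp continuous_snd
  have hc3 : Continuous (fun q : ℝ × ℝ => g (P q.1 q.2)) := hg.continuous.comp hPc
  have hc4 : Continuous (fun q : ℝ × ℝ => fderiv ℝ g (P q.1 q.2)) := hgc.comp hPc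
  have hinv : ContinuousOn (fun q : ℝ × ℝ => (q.1 : ℂ)⁻¹)
      (Set.Icc ε R ×ˢ Set.Icc (-Real.pi) Real.pi) := by
    refine ContinuousOn.inv₀ (by fun_prop) fun q hq => ?_
    exact_mod_cast (hpos q.1 hq.1).ne'
  have hinv2 : ContinuousOn (fun q : ℝ × ℝ => ((q.1 : ℂ) ^ 2)⁻¹)
      (Set.Icc ε R ×ˢ Set.Icc (-Real.pi) Real.pi) := by
    simpa only [inv_pow] using hinv.fun_pow 2
  have hD1 : IntegrableOn (fun q : ℝ × ℝ => D1 q.1 q.2) T := by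
    refine (ContinuousOn.integrableOn_compact hTc ?_).mono_set hTsub
    exact ((hinv2.neg.mul hc1.continuousOn).smul hc3.continuousOn).add
      ((hinv.mul hc1.continuousOn).smul (hc4.clm_apply hc2).continuousOn)
  have hD2 : IntegrableOn (fun q : ℝ × ℝ => ((q.1 : ℂ) ^ 2)⁻¹ • D2 q.1 q.2) T := by
    refine (ContinuousOn.integrableOn_compact hTc ?_).mono_set hTsub
    refine hinv2.smul (Continuous.continuousOn ?_)
    refine (hc1.smul hc3).add ((continuous_const.mul hc1).smul (hc4.clm_apply ?_))
    exact (Complex.continuous_ofReal.comp continuous_fst).mul (continuous_const.mul hc2)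
  have hdP : ∀ r θ, HasDerivAt (fun θ => g (P r θ))
      (fderiv ℝ g (P r θ) (r * (Complex.I * unitPoint θ))) θ := fun r θ =>
    (hgd (P r θ)).hasFDerivAt.comp_hasDerivAt θ ((hasDerivAt_unitPoint θ).const_mul (r : ℂ))
  have hdP' : ∀ r θ, HasDerivAt (fun r : ℝ => g (P r θ)) (fderiv ℝ g (P r θ) (unitPoint θ)) r := by
    intro r θ
    refine (hgd (P r θ)).hasFDerivAt.comp_hasDerivAt r (f := fun r : ℝ => P r θ) ?_
    simpa using ((hasDerivAt_id r).ofReal_comp).mul_const (unitPoint θ)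
  -- The angular derivative integrates to zero by periodicity in θ.
  have i2 : ∫ q in T, ((q.1 : ℂ) ^ 2)⁻¹ • D2 q.1 q.2 = 0 := by
    rw [Measure.volume_eq_prod, setIntegral_prod _ hD2]
    refine integral_eq_zero_of_ae (Eventually.of_forall fun r => ?_)
    simp only [Pi.zero_apply]
    rw [integral_smul, ← integral_Ioc_eq_integral_Ioo,
      ← intervalIntegral.integral_of_le (by linarith [Real.pi_pos])]
    have hder : ∀ θ ∈ Set.uIcc (-Real.pi) Real.pi, HasDerivAt
        (fun θ => (Complex.I * unitPointConj θ) • g (P r θ)) (D2 r θ) θ := by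
      intro θ _
      refine (((hasDerivAt_unitPointConj θ).const_mul Complex.I).fun_smul (hdP r θ)).congr_deriv ?_
      simp only [D2]
      rw [add_comm]
      congr 2
      linear_combination -(unitPointConj θ) * Complex.I_sq
    rw [intervalIntegral.integral_eq_sub_of_hasDerivAt hder]
    · simp [P, unitPoint, unitPointConj]
    · apply Continuous.intervalIntegrable
      have hPr : Continuous (P r) := continuous_const.mul continuous_unitPoint
      refine (continuous_unitPointConj.smul (hg.continuous.comp hPr)).add
        ((continuous_const.mul continuous_unitPointConj).smul ((hgc.comp hPr).clm_apply ?_))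
      exact continuous_const.mul (continuous_const.mul continuous_unitPoint)
  -- The radial derivative leaves the boundary term at ε; the one at R vanishes with g.
  have i1 : ∫ q in T, D1 q.1 q.2 = - ∫ θ in (-Real.pi)..Real.pi,
      ((ε : ℂ)⁻¹ * unitPointConj θ) • g (ε * unitPoint θ) := by
    have hD1' := hD1
    rw [IntegrableOn, Measure.volume_eq_prod, ← Measure.prod_restrict] at hD1'
    rw [Measure.volume_eq_prod, ← Measure.prod_restrict, integral_prod_symm _ hD1',
      intervalIntegral.integral_of_le (by linarith [Real.pi_pos]), integral_Ioc_eq_integral_Ioo,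
      ← integral_neg]
    refine setIntegral_congr_fun measurableSet_Ioo fun θ _ => ?_
    simp only
    rw [← intervalIntegral.integral_of_le hRε]
    have hder : ∀ r ∈ Set.uIcc ε R, HasDerivAt
        (fun r : ℝ => ((r : ℂ)⁻¹ * unitPointConj θ) • g (P r θ)) (D1 r θ) r := by
      intro r hr
      rw [Set.uIcc_of_le hRε] at hr
      have hr' : (r : ℂ) ≠ 0 := by exact_mod_cast (hpos r hr).ne'
      have h1 := ((hasDerivAt_id' r).ofReal_comp.fun_inv hr').mul_const (unitPointConj θ)
      refine (h1.fun_smul (hdP' r θ)).congr_deriv ?_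
      simp only [D1]
      rw [add_comm]
      congr 2
      push_cast
      ring
    rw [intervalIntegral.integral_eq_sub_of_hasDerivAt hder]
    · have : g (P R θ) = 0 := hg0 _ (by
        simp only [P, norm_mul, norm_unitPoint, mul_one, Complex.norm_real]
        exact le_abs_self R)
      simp [this, P]
    · apply ContinuousOn.intervalIntegrable
      rw [Set.uIcc_of_le hRε]
      have hm : ContinuousOn (fun r : ℝ => (r, θ)) (Set.Icc ε R) := by fun_prop
      have hmaps : Set.MapsTo (fun r : ℝ => (r, θ)) (Set.Icc ε R) (Set.Icc ε R ×ˢ Set.univ) :=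
        fun r hr => ⟨hr, trivial⟩
      have hi : ContinuousOn (fun r : ℝ => (r : ℂ)⁻¹) (Set.Icc ε R) := by
        refine ContinuousOn.inv₀ (by fun_prop) fun q hq => ?_
        exact_mod_cast (hpos q hq).ne'
      have hi2 : ContinuousOn (fun r : ℝ => ((r : ℂ) ^ 2)⁻¹) (Set.Icc ε R) := by
        simpa only [inv_pow] using hi.fun_pow 2
      have hPr : Continuous (fun r => P r θ) := by fun_prop
      exact ((hi2.neg.mul continuousOn_const).smul (hg.continuous.comp hPr).continuousOn).add
        ((hi.mul continuousOn_const).smul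
          ((hgc.comp hPr).clm_apply continuous_const).continuousOn)
  have hS : MeasurableSet {w : ℂ | ε < ‖w‖} := measurableSet_lt measurable_const measurable_norm
  calc ∫ w in {w : ℂ | ε < ‖w‖}, (w ^ 2)⁻¹ • wirtingerBar (fderiv ℝ g w)
      = ∫ w, {w : ℂ | ε < ‖w‖}.indicator
          (fun w => (w ^ 2)⁻¹ • wirtingerBar (fderiv ℝ g w)) w := (integral_indicator hS).symm
    _ = ∫ q in polarCoord.target, q.1 • {w : ℂ | ε < ‖w‖}.indicator
          (fun w => (w ^ 2)⁻¹ • wirtingerBar (fderiv ℝ g w)) (P q.1 q.2) := by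
        rw [← Complex.integral_comp_polarCoord_symm]
        simp only [polarCoord_symm_eq, P]
    _ = ∫ q in T, q.1 • {w : ℂ | ε < ‖w‖}.indicator
          (fun w => (w ^ 2)⁻¹ • wirtingerBar (fderiv ℝ g w)) (P q.1 q.2) := by
        refine setIntegral_eq_of_subset_of_forall_sdiff_eq_zero polarCoord.open_target.measurableSet
          (fun q hq => ⟨hε.trans hq.1.1, hq.2⟩) fun q hq => ?_
        have hn : ‖P q.1 q.2‖ = q.1 := by
          have : (0 : ℝ) < q.1 := hq.1.1
          simp only [P, norm_mul, norm_unitPoint, mul_one, Complex.norm_real]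
          exact abs_of_pos this
        by_cases h1 : ε < q.1
        · have h2 : R ≤ q.1 := by
            by_contra h3
            exact hq.2 ⟨⟨h1, (not_le.1 h3).le⟩, hq.1.2⟩
          rw [Set.indicator_of_mem (by rwa [Set.mem_ofPred_eq, hn]), hf0 _ (by rwa [hn])]
          simp
        · rw [Set.indicator_of_notMem (by rwa [Set.mem_ofPred_eq, hn]), smul_zero]
    _ = ∫ q in T, (2⁻¹ : ℂ) • (D1 q.1 q.2 + ((q.1 : ℂ) ^ 2)⁻¹ • D2 q.1 q.2) := by
        refine setIntegral_congr_fun hTm fun q hq => ?_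
        have h0 : (0 : ℝ) < q.1 := hε.trans hq.1.1
        have hn : ‖P q.1 q.2‖ = q.1 := by
          simp only [P, norm_mul, norm_unitPoint, mul_one, Complex.norm_real]
          exact abs_of_pos h0
        rw [Set.indicator_of_mem (by rw [Set.mem_ofPred_eq, hn]; exact hq.1.1)]
        exact key _ _ h0.ne'
    _ = _ := by
        rw [integral_smul, integral_add hD1 hD2, i1, i2]
        simp

/-- Since e^{-iθ} has mean zero, g(0) may be subtracted. The integrand becomes a difference quotient
that is dominated by the Lipschitz constant of g and converges to e^{-iθ}Dg(0)e^{iθ}. -/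
theorem tendsto_circle_average_wirtinger [CompleteSpace X] {g : ℂ → X} (hg : ContDiff ℝ 1 g)
    (hs : HasCompactSupport g) :
    Tendsto (fun ε : ℝ => ∫ θ in (-Real.pi)..Real.pi,
      ((ε : ℂ)⁻¹ * unitPointConj θ) • g (ε * unitPoint θ)) (𝓝[>] 0)
      (𝓝 ((2 * Real.pi : ℂ) • wirtinger (fderiv ℝ g 0))) := by
  obtain ⟨C, hC⟩ := hg.lipschitzWith_of_hasCompactSupport hs (by simp)
  rw [← integral_unitPointConj_smul]
  have hgd : HasFDerivAt g (fderiv ℝ g 0) 0 := (hg.differentiable (by simp) 0).hasFDerivAt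
  have e : ∀ ε : ℝ, 0 < ε → ∫ θ in (-Real.pi)..Real.pi,
      ((ε : ℂ)⁻¹ * unitPointConj θ) • g (ε * unitPoint θ) = ∫ θ in (-Real.pi)..Real.pi,
      unitPointConj θ • (ε⁻¹ • (g (ε * unitPoint θ) - g 0)) := by
    intro ε hε
    have h0 : ∫ θ in (-Real.pi)..Real.pi, unitPointConj θ • ((ε : ℂ)⁻¹ • g 0) = 0 := by
      rw [intervalIntegral.integral_smul_const, integral_unitPointConj, zero_smul]
    have hcont : Continuous fun θ => g (ε * unitPoint θ) :=
      hg.continuous.comp (continuous_const.mul continuous_unitPoint)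
    rw [← sub_zero (∫ θ in (-Real.pi)..Real.pi, _), ← h0, ← intervalIntegral.integral_sub]
    · congr 1
      ext θ
      rw [← Complex.coe_smul]
      push_cast
      module
    · exact ((continuous_const.mul continuous_unitPointConj).smul hcont).intervalIntegrable _ _
    · exact (continuous_unitPointConj.smul continuous_const).intervalIntegrable _ _
  refine Tendsto.congr' (f₁ := fun ε : ℝ => ∫ θ in (-Real.pi)..Real.pi,
      unitPointConj θ • (ε⁻¹ • (g (ε * unitPoint θ) - g 0))) ?_ ?_
  · filter_upwards [self_mem_nhdsWithin] with ε hε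
    exact (e ε hε).symm
  refine intervalIntegral.tendsto_integral_filter_of_dominated_convergence (fun _ => (C : ℝ))
    ?_ ?_ (by simp) ?_
  · refine Eventually.of_forall fun ε => Continuous.aestronglyMeasurable ?_
    refine continuous_unitPointConj.smul (continuous_const.smul (Continuous.sub ?_ continuous_const))
    exact hg.continuous.comp (continuous_const.mul continuous_unitPoint)
  · filter_upwards [self_mem_nhdsWithin] with ε (hε : 0 < ε)
    refine Eventually.of_forall fun θ _ => ?_
    rw [norm_smul, norm_unitPointConj, one_mul, norm_smul, norm_inv, Real.norm_of_nonneg hε.le]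
    have := hC.norm_sub_le (ε * unitPoint θ) 0
    rw [sub_zero, norm_mul, norm_unitPoint, mul_one, Complex.norm_real,
      Real.norm_of_nonneg hε.le] at this
    rw [inv_mul_le_iff₀ hε]
    linarith
  · refine Eventually.of_forall fun θ _ => Tendsto.const_smul ?_ _
    have h1 : HasDerivAt (fun ε : ℝ => g (ε * unitPoint θ)) (fderiv ℝ g 0 (unitPoint θ)) 0 := by
      refine HasFDerivAt.comp_hasDerivAt (f := fun ε : ℝ => (ε : ℂ) * unitPoint θ) 0 ?_ ?_
      · simpa using hgd
      · simpa using ((hasDerivAt_id (0 : ℝ)).ofReal_comp).mul_const (unitPoint θ)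
    have h2 := h1.tendsto_slope_zero_right
    simpa using h2

/-- The Beurling–Ahlfors transform maps `∂̄g` to `∂g`. -/
theorem beurlingAhlfors_wirtingerBar [CompleteSpace X] {g : ℂ → X} (hg : ContDiff ℝ 1 g)
    (hs : HasCompactSupport g) (z : ℂ) :
    beurlingAhlfors (fun w => wirtingerBar (fderiv ℝ g w)) z = wirtinger (fderiv ℝ g z) := by
  -- Translation moves the singularity to the origin; the kernel is even, so the sign of z - w is
  -- harmless.
  let G : ℂ → X := fun w => g (z + w)
  have hG : ContDiff ℝ 1 G := hg.comp (contDiff_const.add contDiff_id)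
  have hGs : HasCompactSupport G := hs.comp_homeomorph (Homeomorph.addLeft z)
  have hGf : ∀ w, fderiv ℝ G w = fderiv ℝ g (z + w) := fun w => fderiv_comp_add_left z
  have e : ∀ ε : ℝ, 0 < ε → truncatedBeurlingAhlfors ε (fun w => wirtingerBar (fderiv ℝ g w)) z
      = (2 * Real.pi : ℂ)⁻¹ • ∫ θ in (-Real.pi)..Real.pi,
          ((ε : ℂ)⁻¹ * unitPointConj θ) • G (ε * unitPoint θ) := by
    intro ε hε
    have h1 := setIntegral_inv_sq_smul_wirtingerBar hG hGs hε
    have hS : MeasurableSet {w : ℂ | ε < ‖w‖} := measurableSet_lt measurable_const measurable_norm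
    have hS' : MeasurableSet {w : ℂ | ε < ‖z - w‖} :=
      measurableSet_lt measurable_const (by fun_prop)
    have h2 : ∫ w in {w : ℂ | ε < ‖z - w‖}, ((z - w) ^ 2)⁻¹ • wirtingerBar (fderiv ℝ g w)
        = ∫ w in {w : ℂ | ε < ‖w‖}, (w ^ 2)⁻¹ • wirtingerBar (fderiv ℝ G w) := by
      rw [← integral_indicator hS, ← integral_indicator hS',
        ← integral_add_left_eq_self _ z]
      congr 1
      ext w
      simp only [Set.indicator, Set.mem_ofPred_eq, hGf, sub_add_cancel_left, norm_neg, neg_sq]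
    unfold truncatedBeurlingAhlfors
    rw [h2, h1, smul_smul]
    congr 1
    rw [mul_inv]
    ring
  -- The factors -1/π and -1/2 give 1/(2π), which cancels the 2π of the circle average.
  refine Tendsto.limUnder_eq ?_
  have h3 := (tendsto_circle_average_wirtinger hG hGs).const_smul (2 * Real.pi : ℂ)⁻¹
  rw [smul_smul, inv_mul_cancel₀ (by simp [Real.pi_ne_zero]), one_smul, hGf, add_zero] at h3
  refine h3.congr' ?_
  filter_upwards [self_mem_nhdsWithin] with ε hε
  exact (e ε hε).symm

end PolarCoordinates
/-! ### The norm inequality for compactly supported smooth functions -/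

section FiniteDimensionalRange

variable {X : Type u} [NormedAddCommGroup X] [NormedSpace ℂ X]

/-- The values of `g` lie in a finite dimensional subspace. -/
def HasFiniteDimRange (g : ℂ → X) : Prop :=
  ∃ V : Submodule ℂ X, FiniteDimensional ℂ V ∧ ∀ z, g z ∈ V

theorem HasFiniteDimRange.add {g h : ℂ → X} (hg : HasFiniteDimRange g)
    (hh : HasFiniteDimRange h) : HasFiniteDimRange (fun z => g z + h z) := by
  obtain ⟨V, hV, hgV⟩ := hg
  obtain ⟨W, hW, hhW⟩ := hh
  exact ⟨V ⊔ W, inferInstance, fun z => Submodule.add_mem_sup (hgV z) (hhW z)⟩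

theorem HasFiniteDimRange.smul {g : ℂ → X} (hg : HasFiniteDimRange g) (c : ℂ → ℝ) :
    HasFiniteDimRange (fun z => c z • g z) := by
  obtain ⟨V, hV, hgV⟩ := hg
  refine ⟨V, hV, fun z => ?_⟩
  simp only [← Complex.coe_smul]
  exact V.smul_mem _ (hgV z)

theorem HasFiniteDimRange.comp {g : ℂ → X} (hg : HasFiniteDimRange g) (e : ℂ → ℂ) :
    HasFiniteDimRange (fun z => g (e z)) := by
  obtain ⟨V, hV, hgV⟩ := hg
  exact ⟨V, hV, fun z => hgV _⟩

theorem hasFiniteDimRange_smul_const (c : ℂ → ℝ) (x : X) :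
    HasFiniteDimRange (fun z => c z • x) :=
  HasFiniteDimRange.smul (g := fun _ => x)
    ⟨Submodule.span ℂ {x}, inferInstance, fun _ => Submodule.mem_span_singleton_self x⟩ c

/-- A finite dimensional subspace has a continuous projection, so its coordinates extend to
continuous functionals on X. The scalar coefficients of g thereby inherit smoothness and compact
support. -/
theorem HasFiniteDimRange.exists_coordinates {g : ℂ → X} (hg : HasFiniteDimRange g) :
    ∃ (K : ℕ) (l : Fin K → X →L[ℂ] ℂ) (x : Fin K → X), ∀ z, g z = ∑ k, l k (g z) • x k := by
  obtain ⟨V, hV, hgV⟩ := hg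
  obtain ⟨π, hπ⟩ := Submodule.ClosedComplemented.of_finiteDimensional (𝕜 := ℂ) V
  let b := Module.finBasis ℂ V
  refine ⟨Module.finrank ℂ V, fun k => (LinearMap.toContinuousLinearMap (b.coord k)).comp π,
    fun k => b k, fun z => ?_⟩
  have h1 : π (g z) = ⟨g z, hgV z⟩ := hπ ⟨g z, hgV z⟩
  have h2 := congrArg V.subtype (b.sum_repr ⟨g z, hgV z⟩)
  rw [map_sum] at h2
  simp only [ContinuousLinearMap.comp_apply, h1]
  exact h2.symm

theorem HasFiniteDimRange.isSchwartzTensor {f : ℂ → X} (hf : HasFiniteDimRange f)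
    (hd : ContDiff ℝ (⊤ : ℕ∞) f) (hs : HasCompactSupport f) : IsSchwartzTensor f := by
  obtain ⟨K, l, x, h⟩ := hf.exists_coordinates
  have hs' : ∀ k, HasCompactSupport (fun z => l k (f z)) := fun k =>
    hs.comp_left (g := l k) (map_zero _)
  have hd' : ∀ k, ContDiff ℝ (⊤ : ℕ∞) (fun z => l k (f z)) := fun k =>
    ((l k).restrictScalars ℝ).contDiff.comp hd
  refine ⟨K, fun k => (hs' k).toSchwartzMap (hd' k), x, ?_⟩
  ext z
  exact h z

/-- Differentiating the coordinate expansion keeps the derivative in the span of the same vectors.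
This makes ∂̄g an admissible input for BA. -/
theorem HasFiniteDimRange.wirtingerBar {g : ℂ → X} (hg : HasFiniteDimRange g)
    (hd : Differentiable ℝ g) : HasFiniteDimRange (fun z => wirtingerBar (fderiv ℝ g z)) := by
  obtain ⟨K, l, x, h⟩ := hg.exists_coordinates
  refine ⟨Submodule.span ℂ (Set.range x), FiniteDimensional.span_of_finite ℂ (Set.finite_range x),
    fun z => ?_⟩
  have hD : ∀ v, fderiv ℝ g z v = ∑ k, (l k) (fderiv ℝ g z v) • x k := by
    intro v
    have h1 : HasFDerivAt g (∑ k, (((l k).restrictScalars ℝ).comp (fderiv ℝ g z)).smulRight (x k))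
        z := by
      have h2 := HasFDerivAt.fun_sum (u := Finset.univ) fun k (_ : k ∈ Finset.univ) =>
        ((((l k).restrictScalars ℝ).hasFDerivAt.comp z (hd z).hasFDerivAt).smul_const (x k))
      exact h2.congr_of_eventuallyEq (Eventually.of_forall h)
    conv_lhs => rw [h1.fderiv]
    simp
  have hmem : ∀ v, fderiv ℝ g z v ∈ Submodule.span ℂ (Set.range x) := by
    intro v
    rw [hD v]
    exact Submodule.sum_mem _ fun k _ =>
      Submodule.smul_mem _ _ (Submodule.subset_span (Set.mem_range_self k))
  exact Submodule.smul_mem _ _ (Submodule.add_mem _ (hmem _) (Submodule.smul_mem _ _ (hmem _)))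

theorem continuous_wirtingerBar_fderiv {g : ℂ → X} (hg : ContDiff ℝ (⊤ : ℕ∞) g) :
    Continuous (fun z => wirtingerBar (fderiv ℝ g z)) :=
  continuous_wirtingerBar.comp (hg.continuous_fderiv (by simp))

theorem continuous_wirtinger_fderiv {g : ℂ → X} (hg : ContDiff ℝ (⊤ : ℕ∞) g) :
    Continuous (fun z => wirtinger (fderiv ℝ g z)) :=
  continuous_wirtinger.comp (hg.continuous_fderiv (by simp))

/-- A bound for the Beurling–Ahlfors transform on `𝓢(ℝ²) ⊗ X` compares `∂g` with `∂̄g`. -/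
theorem integral_norm_wirtinger_rpow_le [CompleteSpace X] {p : ℝ≥0∞} (hp : 1 < p) (hp' : p < ∞)
    {C : ℝ≥0∞} (hC' : C ≠ ∞) (hC : ∀ f : ℂ → X, IsSchwartzTensor f →
      eLpNorm (beurlingAhlfors f) p volume ≤ C * eLpNorm f p volume)
    {g : ℂ → X} (hg : ContDiff ℝ (⊤ : ℕ∞) g) (hs : HasCompactSupport g) (hfd : HasFiniteDimRange g) :
    ∫ z, ‖wirtinger (fderiv ℝ g z)‖ ^ p.toReal
      ≤ C.toReal ^ p.toReal * ∫ z, ‖wirtingerBar (fderiv ℝ g z)‖ ^ p.toReal := by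
  have hp0 : p ≠ 0 := (zero_lt_one.trans hp).ne'
  have hr : 0 < p.toReal := ENNReal.toReal_pos hp0 hp'.ne
  have hsf : HasCompactSupport (fderiv ℝ g) := hs.fderiv ℝ
  have hs1 : HasCompactSupport (fun z => wirtingerBar (fderiv ℝ g z)) :=
    hsf.comp_left (g := wirtingerBar) wirtingerBar_zero
  have hs2 : HasCompactSupport (fun z => wirtinger (fderiv ℝ g z)) :=
    hsf.comp_left (g := wirtinger) wirtinger_zero
  have hc1 := continuous_wirtingerBar_fderiv hg
  have hc2 := continuous_wirtinger_fderiv hg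
  have hdf : ContDiff ℝ (⊤ : ℕ∞) (fderiv ℝ g) := hg.fderiv_right (by simp)
  have hd : ContDiff ℝ (⊤ : ℕ∞) (fun z => wirtingerBar (fderiv ℝ g z)) := by
    unfold wirtingerBar
    exact ((hdf.clm_apply contDiff_const).add
      ((hdf.clm_apply contDiff_const).const_smul Complex.I)).const_smul (2⁻¹ : ℂ)
  have h := hC _ ((hfd.wirtingerBar (hg.differentiable (by simp))).isSchwartzTensor hd hs1)
  have hBA : beurlingAhlfors (fun z => wirtingerBar (fderiv ℝ g z))
      = fun z => wirtinger (fderiv ℝ g z) :=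
    funext fun z => beurlingAhlfors_wirtingerBar (hg.of_le (by simp)) hs z
  have hm1 : MemLp (fun z => wirtingerBar (fderiv ℝ g z)) p volume :=
    hc1.memLp_of_hasCompactSupport hs1
  have hm2 : MemLp (fun z => wirtinger (fderiv ℝ g z)) p volume :=
    hc2.memLp_of_hasCompactSupport hs2
  rw [hBA, hm1.eLpNorm_eq_integral_rpow_norm hp0 hp'.ne,
    hm2.eLpNorm_eq_integral_rpow_norm hp0 hp'.ne, ← ENNReal.ofReal_toReal hC',
    ← ENNReal.ofReal_mul ENNReal.toReal_nonneg, ENNReal.ofReal_le_ofReal_iff (by positivity)] at h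
  have hn1 : 0 ≤ ∫ z, ‖wirtinger (fderiv ℝ g z)‖ ^ p.toReal :=
    integral_nonneg fun z => by positivity
  have hn2 : 0 ≤ ∫ z, ‖wirtingerBar (fderiv ℝ g z)‖ ^ p.toReal :=
    integral_nonneg fun z => by positivity
  have h' := Real.rpow_le_rpow (by positivity) h hr.le
  rwa [Real.mul_rpow ENNReal.toReal_nonneg (by positivity), Real.rpow_inv_rpow hn1 hr.ne',
    Real.rpow_inv_rpow hn2 hr.ne'] at h'

end FiniteDimensionalRange

/-! ### Integrals of doubly periodic functions -/

section Periodic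

/-- The box `(a, b] × (c, d]` in the complex plane. -/
def halfOpenBox (a b c d : ℝ) : Set ℂ := Set.Ioc a b ×ℂ Set.Ioc c d

theorem measurableSet_halfOpenBox (a b c d : ℝ) : MeasurableSet (halfOpenBox a b c d) :=
  (Complex.measurable_re measurableSet_Ioc).inter (Complex.measurable_im measurableSet_Ioc)

variable {E : Type*} [NormedAddCommGroup E]

theorem Continuous.integrableOn_halfOpenBox {F : ℂ → E} (hF : Continuous F) (a b c d : ℝ) :
    IntegrableOn F (halfOpenBox a b c d) :=
  (hF.continuousOn.integrableOn_compact (isCompact_Icc.reProdIm isCompact_Icc)).mono_set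
    fun _ hz => ⟨Set.Ioc_subset_Icc_self hz.1, Set.Ioc_subset_Icc_self hz.2⟩

/-- Periodicity with respect to the lattice of Gaussian integers. -/
structure IsDoublyPeriodic {α : Type*} (F : ℂ → α) : Prop where
  add_one : ∀ z, F (z + 1) = F z
  add_I : ∀ z, F (z + Complex.I) = F z

theorem IsDoublyPeriodic.comp_left {α β : Type*} {F : ℂ → α} (hF : IsDoublyPeriodic F)
    (e : α → β) : IsDoublyPeriodic (fun z => e (F z)) :=
  ⟨fun z => congrArg e (hF.1 z), fun z => congrArg e (hF.2 z)⟩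

theorem IsDoublyPeriodic.add_gaussianInt {α : Type*} {F : ℂ → α} (hF : IsDoublyPeriodic F)
    (m n : ℤ) (z : ℂ) : F (z + (m + n * Complex.I)) = F z := by
  have h1 : Function.Periodic F 1 := hF.1
  have h2 : Function.Periodic F Complex.I := hF.2
  rw [← add_assoc, h2.int_mul n, ← mul_one (m : ℂ), h1.int_mul m]

theorem IsDoublyPeriodic.periodic_im {α : Type*} {F : ℂ → α} (hF : IsDoublyPeriodic F) (x : ℂ) :
    Function.Periodic (fun y : ℝ => F (x + y * Complex.I)) 1 := by
  intro y
  simp only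
  rw [← hF.2 (x + y * Complex.I)]
  push_cast
  ring_nf

theorem IsDoublyPeriodic.exists_mem_square {α : Type*} {F : ℂ → α} (hF : IsDoublyPeriodic F)
    (z : ℂ) : ∃ w ∈ Set.Icc (0 : ℝ) 1 ×ℂ Set.Icc (0 : ℝ) 1, F z = F w := by
  refine ⟨z + ((-⌊z.re⌋ : ℤ) + (-⌊z.im⌋ : ℤ) * Complex.I), ⟨?_, ?_⟩,
    (hF.add_gaussianInt _ _ z).symm⟩
  · have h1 := Int.fract_nonneg z.re
    have h2 := Int.fract_lt_one z.re
    rw [Int.fract] at h1 h2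
    simp
    constructor <;> linarith
  · have h1 := Int.fract_nonneg z.im
    have h2 := Int.fract_lt_one z.im
    rw [Int.fract] at h1 h2
    simp
    constructor <;> linarith

theorem IsDoublyPeriodic.exists_norm_le {F : ℂ → E} (hF : IsDoublyPeriodic F)
    (hc : Continuous F) : ∃ M, 0 ≤ M ∧ ∀ z, ‖F z‖ ≤ M := by
  obtain ⟨M, hM⟩ := (isCompact_Icc.reProdIm isCompact_Icc :
    IsCompact (Set.Icc (0 : ℝ) 1 ×ℂ Set.Icc (0 : ℝ) 1)).exists_bound_of_continuousOn
    hc.continuousOn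
  refine ⟨max M 0, le_max_right _ _, fun z => ?_⟩
  obtain ⟨w, hw, h⟩ := hF.exists_mem_square z
  rw [h]
  exact (hM w hw).trans (le_max_left _ _)

/-- Lebesgue measure on the unit square. -/
noncomputable def squareMeasure : Measure ℂ := volume.restrict (halfOpenBox 0 1 0 1)

theorem Continuous.integrable_squareMeasure {F : ℂ → E} (hF : Continuous F) :
    Integrable F squareMeasure :=
  hF.integrableOn_halfOpenBox 0 1 0 1

variable [NormedSpace ℝ E]

theorem setIntegral_halfOpenBox {F : ℂ → E} (hF : Continuous F) {a b c d : ℝ} (hab : a ≤ b)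
    (hcd : c ≤ d) : ∫ z in halfOpenBox a b c d, F z
      = ∫ x in a..b, ∫ y in c..d, F (x + y * Complex.I) := by
  have h1 := Complex.volume_preserving_equiv_real_prod.symm.setIntegral_preimage_emb
    Complex.measurableEquivRealProd.symm.measurableEmbedding F (halfOpenBox a b c d)
  have h2 : Complex.measurableEquivRealProd.symm ⁻¹' (halfOpenBox a b c d)
      = Set.Ioc a b ×ˢ Set.Ioc c d := by
    ext q
    rfl
  have h3 : ∀ q : ℝ × ℝ, Complex.measurableEquivRealProd.symm q = q.1 + q.2 * Complex.I := by
    intro q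
    apply Complex.ext <;> simp [Complex.measurableEquivRealProd]
  rw [← h1, h2, Measure.volume_eq_prod, setIntegral_prod, intervalIntegral.integral_of_le hab]
  · refine setIntegral_congr_fun measurableSet_Ioc fun x _ => ?_
    simp only [h3]
    rw [intervalIntegral.integral_of_le hcd]
  · simp only [h3]
    refine (ContinuousOn.integrableOn_compact (isCompact_Icc.prod isCompact_Icc)
      (Continuous.continuousOn (by fun_prop))).mono_set
      (Set.prod_mono Set.Ioc_subset_Icc_self Set.Ioc_subset_Icc_self)

theorem volume_halfOpenBox {a b c d : ℝ} (hab : a ≤ b) (hcd : c ≤ d) :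
    volume.real (halfOpenBox a b c d) = (b - a) * (d - c) := by
  have h := setIntegral_halfOpenBox (F := fun _ => (1 : ℝ)) continuous_const hab hcd
  rw [mul_sub]
  simpa [mul_sub] using h

instance : IsProbabilityMeasure squareMeasure := by
  refine ⟨?_⟩
  have h := volume_halfOpenBox (zero_le_one' ℝ) (zero_le_one' ℝ)
  rw [squareMeasure, Measure.restrict_apply_univ]
  have h' : volume (halfOpenBox 0 1 0 1) ≠ ∞ := by
    intro h0
    simp [Measure.real, h0] at h
  rw [← ENNReal.ofReal_toReal h', ← Measure.real, h]
  simp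

theorem integral_squareMeasure {F : ℂ → E} (hF : Continuous F) :
    ∫ z, F z ∂squareMeasure = ∫ x in (0 : ℝ)..1, ∫ y in (0 : ℝ)..1, F (x + y * Complex.I) :=
  setIntegral_halfOpenBox hF zero_le_one zero_le_one

theorem IsDoublyPeriodic.periodic_integral {F : ℂ → E} (hF : IsDoublyPeriodic F) (c d : ℝ) :
    Function.Periodic (fun x : ℝ => ∫ y in c..d, F (x + y * Complex.I)) 1 := by
  intro x
  refine intervalIntegral.integral_congr fun y _ => ?_
  rw [← hF.1 (x + y * Complex.I)]
  push_cast
  ring_nf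

theorem continuous_integral_im {F : ℂ → E} (hc : Continuous F) (c d : ℝ) :
    Continuous (fun x : ℝ => ∫ y in c..d, F (x + y * Complex.I)) := by
  apply intervalIntegral.continuous_parametric_intervalIntegral_of_continuous'
  unfold Function.uncurry
  fun_prop

theorem IsDoublyPeriodic.integral_add_right {F : ℂ → E} (hF : IsDoublyPeriodic F)
    (hc : Continuous F) (s : ℂ) :
    ∫ z, F (z + s) ∂squareMeasure = ∫ z, F z ∂squareMeasure := by
  rw [integral_squareMeasure (by fun_prop), integral_squareMeasure hc]
  have key : ∀ (G : ℝ → E) (t : ℝ), Function.Periodic G 1 →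
      ∫ x in (0 : ℝ)..1, G (x + t) = ∫ x in (0 : ℝ)..1, G x := by
    intro G t hG
    rw [intervalIntegral.integral_comp_add_right, zero_add, add_comm 1 t,
      hG.intervalIntegral_add_eq t 0, zero_add]
  rw [← key _ s.re (hF.periodic_integral 0 1)]
  refine intervalIntegral.integral_congr fun x _ => ?_
  rw [← key _ s.im (hF.periodic_im (x + s.re : ℝ))]
  refine intervalIntegral.integral_congr fun y _ => ?_
  congr 1
  apply Complex.ext <;> simp

theorem IsDoublyPeriodic.setIntegral_largeBox {F : ℂ → E} (hF : IsDoublyPeriodic F)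
    (hc : Continuous F) (N : ℕ) :
    ∫ z in halfOpenBox (-N) N (-N) N, F z = ((2 * N : ℝ) ^ 2) • ∫ z, F z ∂squareMeasure := by
  have hN : (-N : ℝ) ≤ N := by linarith [(Nat.cast_nonneg N : (0 : ℝ) ≤ N)]
  have key : ∀ G : ℝ → E, Function.Periodic G 1 → Continuous G →
      ∫ x in (-N : ℝ)..N, G x = (2 * N : ℝ) • ∫ x in (0 : ℝ)..1, G x := by
    intro G hG hGc
    have h := hG.intervalIntegral_add_zsmul_eq (2 * N) (-N)
      fun a b => hGc.intervalIntegrable a b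
    rw [hG.intervalIntegral_add_eq (-N) 0, zero_add, ← Int.cast_smul_eq_zsmul ℝ,
      ← Int.cast_smul_eq_zsmul ℝ] at h
    push_cast at h
    rw [← h]
    congr 1
    simp only [smul_eq_mul]
    ring
  rw [setIntegral_halfOpenBox hc hN hN, integral_squareMeasure hc,
    key _ (hF.periodic_integral _ _) (continuous_integral_im hc _ _)]
  simp_rw [fun x : ℝ => key _ (hF.periodic_im x) (by fun_prop)]
  rw [intervalIntegral.integral_smul, smul_smul, sq]

end Periodic
/-! ### The norm inequality for periodic functions -/

section Cutoff

/-- The derivative is continuous and vanishes off [0, 1], hence bounded. -/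
theorem exists_smoothTransition_lipschitz :
    ∃ L : ℝ, 0 ≤ L ∧ ∀ x y, |Real.smoothTransition x - Real.smoothTransition y| ≤ L * |x - y| := by
  have hd : ContDiff ℝ 1 Real.smoothTransition := Real.smoothTransition.contDiff (n := 1)
  have hc : Continuous (deriv Real.smoothTransition) := hd.continuous_deriv le_rfl
  obtain ⟨L, hL⟩ := (isCompact_Icc : IsCompact (Set.Icc (0 : ℝ) 1)).exists_bound_of_continuousOn
    hc.continuousOn
  have hL0 : 0 ≤ L := (norm_nonneg _).trans (hL 0 (by simp))
  have hb : ∀ x, ‖deriv Real.smoothTransition x‖ ≤ L := by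
    intro x
    by_cases hx : x ∈ Set.Icc (0 : ℝ) 1
    · exact hL x hx
    · have h0 : deriv Real.smoothTransition x = 0 := by
        rw [Set.mem_Icc, not_and_or, not_le, not_le] at hx
        rcases hx with hx | hx
        · have : Real.smoothTransition =ᶠ[𝓝 x] fun _ => 0 := by
            filter_upwards [Iio_mem_nhds hx] with y hy
            exact Real.smoothTransition.zero_of_nonpos (le_of_lt hy)
          rw [this.deriv_eq, deriv_const]
        · have : Real.smoothTransition =ᶠ[𝓝 x] fun _ => 1 := by
            filter_upwards [Ioi_mem_nhds hx] with y hy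
            exact Real.smoothTransition.one_of_one_le (le_of_lt hy)
          rw [this.deriv_eq, deriv_const]
      rw [h0, norm_zero]
      exact hL0
  refine ⟨L, hL0, fun x y => ?_⟩
  exact Convex.norm_image_sub_le_of_norm_deriv_le (s := Set.univ)
    (fun z _ => hd.differentiable (by simp) z) (fun z _ => hb z) convex_univ
    (Set.mem_univ _) (Set.mem_univ _)

/-- Bounded by one and Lipschitz with constant `K`. -/
def IsUnitLipschitz (K : ℝ) (f : ℂ → ℝ) : Prop :=
  (∀ z, |f z| ≤ 1) ∧ ∀ z w, |f z - f w| ≤ K * ‖z - w‖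

theorem IsUnitLipschitz.mul {K L : ℝ} {f g : ℂ → ℝ} (hf : IsUnitLipschitz K f)
    (hg : IsUnitLipschitz L g) : IsUnitLipschitz (K + L) (fun z => f z * g z) := by
  refine ⟨fun z => ?_, fun z w => ?_⟩
  · rw [abs_mul]
    exact mul_le_one₀ (hf.1 z) (abs_nonneg _) (hg.1 z)
  · calc |f z * g z - f w * g w| = |(f z - f w) * g z + f w * (g z - g w)| := by ring_nf
      _ ≤ |f z - f w| * |g z| + |f w| * |g z - g w| := by
        rw [← abs_mul, ← abs_mul]
        exact abs_add_le _ _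
      _ ≤ (K * ‖z - w‖) * 1 + 1 * (L * ‖z - w‖) := by
        have h1 := hf.2 z w
        have h2 := hg.2 z w
        have h3 := hg.1 z
        have h4 := hf.1 w
        have h5 := (abs_nonneg _).trans h1
        gcongr
      _ = (K + L) * ‖z - w‖ := by ring

/-- A smooth function that is one on the square `[-N, N]²` and vanishes off `[-N - 1, N + 1]²`. -/
noncomputable def squareCutoff (N : ℝ) (z : ℂ) : ℝ :=
  (Real.smoothTransition (N + 1 - z.re) * Real.smoothTransition (N + 1 + z.re))
    * (Real.smoothTransition (N + 1 - z.im) * Real.smoothTransition (N + 1 + z.im))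

theorem contDiff_squareCutoff (N : ℝ) : ContDiff ℝ (⊤ : ℕ∞) (squareCutoff N) := by
  have hre : ContDiff ℝ (⊤ : ℕ∞) Complex.re := Complex.reCLM.contDiff
  have him : ContDiff ℝ (⊤ : ℕ∞) Complex.im := Complex.imCLM.contDiff
  have hs : ContDiff ℝ (⊤ : ℕ∞) Real.smoothTransition := Real.smoothTransition.contDiff
  exact ((hs.comp (contDiff_const.sub hre)).mul (hs.comp (contDiff_const.add hre))).mul
    ((hs.comp (contDiff_const.sub him)).mul (hs.comp (contDiff_const.add him)))

theorem squareCutoff_eq_one {N : ℝ} {z : ℂ} (h1 : |z.re| ≤ N) (h2 : |z.im| ≤ N) :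
    squareCutoff N z = 1 := by
  rw [abs_le] at h1 h2
  simp only [squareCutoff]
  rw [Real.smoothTransition.one_of_one_le (by linarith),
    Real.smoothTransition.one_of_one_le (by linarith),
    Real.smoothTransition.one_of_one_le (by linarith),
    Real.smoothTransition.one_of_one_le (by linarith)]
  norm_num

theorem squareCutoff_eq_zero {N : ℝ} {z : ℂ} (h : N + 1 < |z.re| ∨ N + 1 < |z.im|) :
    squareCutoff N z = 0 := by
  simp only [squareCutoff, lt_abs] at h ⊢
  rcases h with (h | h) | (h | h)
  · rw [Real.smoothTransition.zero_of_nonpos (x := N + 1 - z.re) (by linarith)]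
    simp
  · rw [Real.smoothTransition.zero_of_nonpos (x := N + 1 + z.re) (by linarith)]
    simp
  · rw [Real.smoothTransition.zero_of_nonpos (x := N + 1 - z.im) (by linarith)]
    simp
  · rw [Real.smoothTransition.zero_of_nonpos (x := N + 1 + z.im) (by linarith)]
    simp

theorem hasCompactSupport_squareCutoff (N : ℝ) : HasCompactSupport (squareCutoff N) := by
  refine HasCompactSupport.intro
    (isCompact_Icc.reProdIm isCompact_Icc :
      IsCompact (Set.Icc (-(N + 1)) (N + 1) ×ℂ Set.Icc (-(N + 1)) (N + 1))) fun z hz => ?_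
  apply squareCutoff_eq_zero
  by_contra! h
  exact hz ⟨abs_le.1 h.1, abs_le.1 h.2⟩

/-- The constant does not depend on N. The derivative of a cut-off field is therefore uniformly
bounded on the transition layer, whose area is only O(N). -/
theorem exists_isUnitLipschitz_squareCutoff :
    ∃ K, 0 ≤ K ∧ ∀ N, IsUnitLipschitz K (squareCutoff N) := by
  obtain ⟨L, hL0, hL⟩ := exists_smoothTransition_lipschitz
  have key : ∀ e : ℂ → ℝ, (∀ z w, |e z - e w| ≤ ‖z - w‖) →
      IsUnitLipschitz L (fun z => Real.smoothTransition (e z)) := by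
    intro e he
    refine ⟨fun z => ?_, fun z w => (hL _ _).trans (by gcongr; exact he z w)⟩
    rw [abs_of_nonneg (Real.smoothTransition.nonneg _)]
    exact Real.smoothTransition.le_one _
  have hre : ∀ z w : ℂ, |z.re - w.re| ≤ ‖z - w‖ := fun z w => by
    simpa using Complex.abs_re_le_norm (z - w)
  have him : ∀ z w : ℂ, |z.im - w.im| ≤ ‖z - w‖ := fun z w => by
    simpa using Complex.abs_im_le_norm (z - w)
  refine ⟨(L + L) + (L + L), by positivity, fun N => ?_⟩
  refine IsUnitLipschitz.mul (IsUnitLipschitz.mul (key _ ?_) (key _ ?_))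
    (IsUnitLipschitz.mul (key _ ?_) (key _ ?_))
  · intro z w
    rw [sub_sub_sub_cancel_left, abs_sub_comm]
    exact hre z w
  · intro z w
    rw [add_sub_add_left_eq_sub]
    exact hre z w
  · intro z w
    rw [sub_sub_sub_cancel_left, abs_sub_comm]
    exact him z w
  · intro z w
    rw [add_sub_add_left_eq_sub]
    exact him z w

end Cutoff

/-! ### Transfer of the derivative inequality from compact support to periodic fields -/

section PeriodicField

variable {X : Type u} [NormedAddCommGroup X] [NormedSpace ℂ X]

/-- Smooth doubly periodic functions with values in a finite dimensional subspace. -/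
structure IsPeriodicField (g : ℂ → X) : Prop where
  contDiff : ContDiff ℝ (⊤ : ℕ∞) g
  periodic : IsDoublyPeriodic g
  finiteDim : HasFiniteDimRange g

theorem isPeriodicField_zero : IsPeriodicField (fun _ => (0 : X)) :=
  ⟨contDiff_const, ⟨fun _ => rfl, fun _ => rfl⟩, ⊥, inferInstance, fun _ => Submodule.zero_mem _⟩

namespace IsPeriodicField

variable {g h : ℂ → X}

theorem differentiable (hg : IsPeriodicField g) : Differentiable ℝ g :=
  hg.contDiff.differentiable (by simp)

theorem continuous_fderiv (hg : IsPeriodicField g) : Continuous (fderiv ℝ g) :=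
  hg.contDiff.continuous_fderiv (by simp)

theorem periodic_fderiv (hg : IsPeriodicField g) : IsDoublyPeriodic (fderiv ℝ g) := by
  refine ⟨fun z => ?_, fun z => ?_⟩
  · rw [← fderiv_comp_add_right]
    congr 1
    exact funext hg.periodic.1
  · rw [← fderiv_comp_add_right]
    congr 1
    exact funext hg.periodic.2

theorem continuous_bar (hg : IsPeriodicField g) :
    Continuous (fun z => wirtingerBar (fderiv ℝ g z)) :=
  continuous_wirtingerBar_fderiv hg.contDiff

theorem continuous_wirtinger (hg : IsPeriodicField g) :
    Continuous (fun z => wirtinger (fderiv ℝ g z)) :=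
  continuous_wirtinger_fderiv hg.contDiff

/-- If `‖∂G‖_r ≤ K^{1/r} ‖∂̄G‖_r` for compactly supported `G`, then also for periodic ones. -/
theorem integral_norm_wirtinger_rpow_le (hg : IsPeriodicField g) {r K : ℝ} (hr : 0 < r)
    (hK : 0 ≤ K)
    (hG : ∀ G : ℂ → X, ContDiff ℝ (⊤ : ℕ∞) G → HasCompactSupport G → HasFiniteDimRange G →
      ∫ z, ‖wirtinger (fderiv ℝ G z)‖ ^ r ≤ K * ∫ z, ‖wirtingerBar (fderiv ℝ G z)‖ ^ r) :
    ∫ z, ‖wirtinger (fderiv ℝ g z)‖ ^ r ∂squareMeasure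
      ≤ K * ∫ z, ‖wirtingerBar (fderiv ℝ g z)‖ ^ r ∂squareMeasure := by
  obtain ⟨L, hL0, hL⟩ := exists_isUnitLipschitz_squareCutoff
  obtain ⟨M₀, hM₀0, hM₀⟩ := hg.periodic.exists_norm_le hg.contDiff.continuous
  obtain ⟨M₁, hM₁0, hM₁⟩ := hg.periodic_fderiv.exists_norm_le hg.continuous_fderiv
  set M := M₁ + L * M₀ with hM
  have hM0 : 0 ≤ M := by positivity
  set a := ∫ z, ‖wirtinger (fderiv ℝ g z)‖ ^ r ∂squareMeasure with ha
  set b := ∫ z, ‖wirtingerBar (fderiv ℝ g z)‖ ^ r ∂squareMeasure with hb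
  have hca : Continuous (fun z => ‖wirtinger (fderiv ℝ g z)‖ ^ r) :=
    hg.continuous_wirtinger.norm.rpow_const fun _ => Or.inr hr.le
  have hcb : Continuous (fun z => ‖wirtingerBar (fderiv ℝ g z)‖ ^ r) :=
    hg.continuous_bar.norm.rpow_const fun _ => Or.inr hr.le
  -- The inequality is applied to g cut off outside a large square: the square of side 2N holds
  -- (2N)² periods, and the surrounding layer costs at most M^r per unit area.
  have key : ∀ N : ℕ, (2 * N : ℝ) ^ 2 * a
      ≤ K * ((2 * N : ℝ) ^ 2 * b + M ^ r * ((2 * N + 6) ^ 2 - (2 * N) ^ 2)) := by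
    intro N
    -- This cutoff is one on a neighbourhood of the box of radius N, so derivatives agree there, and
    -- vanishes beyond radius N + 2, inside the box of radius N + 3.
    let ψ := squareCutoff (N + 1)
    let G : ℂ → X := fun z => ψ z • g z
    have hψ : ContDiff ℝ (⊤ : ℕ∞) ψ := contDiff_squareCutoff _
    have hGd : ContDiff ℝ (⊤ : ℕ∞) G := hψ.smul hg.contDiff
    have hGs : HasCompactSupport G := (hasCompactSupport_squareCutoff _).smul_right
    have hGfd : ∀ z, fderiv ℝ G z = ψ z • fderiv ℝ g z + (fderiv ℝ ψ z).smulRight (g z) :=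
      fun z => fderiv_fun_smul (hψ.differentiable (by simp) z) (hg.differentiable z)
    have hψd : ∀ z, ‖fderiv ℝ ψ z‖ ≤ L := by
      intro z
      refine norm_fderiv_le_of_lip' ℝ hL0 (Eventually.of_forall fun w => ?_)
      exact (hL _).2 w z
    have hGb : ∀ z, ‖fderiv ℝ G z‖ ≤ M := by
      intro z
      rw [hGfd]
      refine (norm_add_le _ _).trans ?_
      rw [norm_smul, ContinuousLinearMap.norm_smulRight_apply]
      have h1 := hM₁ z
      have h2 := hM₀ z
      have h3 := hψd z
      have h4 : ‖ψ z‖ ≤ 1 := (hL _).1 z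
      calc ‖ψ z‖ * ‖fderiv ℝ g z‖ + ‖fderiv ℝ ψ z‖ * ‖g z‖ ≤ 1 * M₁ + L * M₀ := by gcongr
        _ = M := by rw [one_mul]
    have hin : ∀ z ∈ halfOpenBox (-N) N (-N) N, fderiv ℝ G z = fderiv ℝ g z := by
      intro z hz
      have h1 : |z.re| < N + 1 := by
        have := hz.1
        rw [abs_lt]
        constructor <;> linarith [this.1, this.2]
      have h2 : |z.im| < N + 1 := by
        have := hz.2
        rw [abs_lt]
        constructor <;> linarith [this.1, this.2]
      apply Filter.EventuallyEq.fderiv_eq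
      have o1 : ∀ᶠ w : ℂ in 𝓝 z, |w.re| < N + 1 :=
        (Complex.continuous_re.abs.isOpen_preimage _ isOpen_Iio).mem_nhds h1
      have o2 : ∀ᶠ w : ℂ in 𝓝 z, |w.im| < N + 1 :=
        (Complex.continuous_im.abs.isOpen_preimage _ isOpen_Iio).mem_nhds h2
      filter_upwards [o1, o2] with w hw1 hw2
      simp only [G, ψ, squareCutoff_eq_one hw1.le hw2.le, one_smul]
    let B₁ := halfOpenBox (-N) N (-N) N
    let B₂ := halfOpenBox (-(N + 3 : ℕ)) (N + 3 : ℕ) (-(N + 3 : ℕ)) (N + 3 : ℕ)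
    have hB₁ : MeasurableSet B₁ := measurableSet_halfOpenBox _ _ _ _
    have hB₂ : MeasurableSet B₂ := measurableSet_halfOpenBox _ _ _ _
    have hB : B₁ ⊆ B₂ := by
      intro z hz
      have h1 := hz.1
      have h2 := hz.2
      refine ⟨⟨?_, ?_⟩, ⟨?_, ?_⟩⟩ <;> push_cast <;>
        linarith [h1.1, h1.2, h2.1, h2.2]
    have hout : ∀ z, z ∉ B₂ → fderiv ℝ G z = 0 := by
      intro z hz
      have hz' : (N : ℝ) + 2 < |z.re| ∨ (N : ℝ) + 2 < |z.im| := by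
        by_contra! h
        rw [abs_le, abs_le] at h
        refine hz ⟨⟨?_, ?_⟩, ⟨?_, ?_⟩⟩ <;> push_cast <;>
          linarith [h.1.1, h.1.2, h.2.1, h.2.2]
      have h0 : G =ᶠ[𝓝 z] fun _ => 0 := by
        have : ∀ᶠ w : ℂ in 𝓝 z, (N : ℝ) + 2 < |w.re| ∨ (N : ℝ) + 2 < |w.im| :=
          ((Complex.continuous_re.abs.isOpen_preimage _ isOpen_Ioi).union
            (Complex.continuous_im.abs.isOpen_preimage _ isOpen_Ioi)).mem_nhds hz'
        filter_upwards [this] with w hw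
        have : ψ w = 0 := squareCutoff_eq_zero (by
          rcases hw with hw | hw
          · exact Or.inl (by linarith)
          · exact Or.inr (by linarith))
        simp only [G, this, zero_smul]
      rw [h0.fderiv_eq]
      simp
    have hsf : HasCompactSupport (fderiv ℝ G) := hGs.fderiv ℝ
    have hz0 : (‖(0 : X)‖ ^ r) = 0 := by rw [norm_zero, Real.zero_rpow hr.ne']
    have hia : Integrable (fun z => ‖wirtinger (fderiv ℝ G z)‖ ^ r) := by
      refine Continuous.integrable_of_hasCompactSupport
        ((continuous_wirtinger_fderiv hGd).norm.rpow_const fun _ => Or.inr hr.le) ?_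
      refine hsf.comp_left (g := fun L => ‖_root_.wirtinger L‖ ^ r) ?_
      rw [wirtinger_zero, hz0]
    have hib : Integrable (fun z => ‖wirtingerBar (fderiv ℝ G z)‖ ^ r) := by
      refine Continuous.integrable_of_hasCompactSupport
        ((continuous_wirtingerBar_fderiv hGd).norm.rpow_const fun _ => Or.inr hr.le) ?_
      refine hsf.comp_left (g := fun L => ‖wirtingerBar L‖ ^ r) ?_
      rw [wirtingerBar_zero, hz0]
    have hv : ∀ n : ℕ, volume.real (halfOpenBox (-n) n (-n) n) = (2 * n : ℝ) ^ 2 := by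
      intro n
      have hn : (-n : ℝ) ≤ n := by linarith [(Nat.cast_nonneg n : (0 : ℝ) ≤ n)]
      rw [volume_halfOpenBox hn hn]
      ring
    have hfin : ∀ n : ℕ, volume (halfOpenBox (-n) n (-n) n) ≠ ∞ := by
      intro n
      exact (((isCompact_Icc.reProdIm isCompact_Icc : IsCompact
        (Set.Icc (-n : ℝ) n ×ℂ Set.Icc (-n : ℝ) n)).measure_lt_top).trans_le' (measure_mono
          fun _ hz => ⟨Set.Ioc_subset_Icc_self hz.1, Set.Ioc_subset_Icc_self hz.2⟩)).ne
    calc (2 * N : ℝ) ^ 2 * a = ∫ z in B₁, ‖wirtinger (fderiv ℝ g z)‖ ^ r :=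
          ((hg.periodic_fderiv.comp_left fun L => ‖_root_.wirtinger L‖ ^ r).setIntegral_largeBox
            hca N).symm
      _ = ∫ z in B₁, ‖wirtinger (fderiv ℝ G z)‖ ^ r :=
          setIntegral_congr_fun hB₁ fun z hz => by simp only [hin z hz]
      _ ≤ ∫ z, ‖wirtinger (fderiv ℝ G z)‖ ^ r :=
          setIntegral_le_integral hia (Eventually.of_forall fun z => by positivity)
      _ ≤ K * ∫ z, ‖wirtingerBar (fderiv ℝ G z)‖ ^ r :=
          hG G hGd hGs (hg.finiteDim.smul ψ)
      _ ≤ K * ((2 * N : ℝ) ^ 2 * b + M ^ r * ((2 * N + 6) ^ 2 - (2 * N) ^ 2)) := by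
          gcongr
          have hi1 : IntegrableOn (fun z => ‖wirtingerBar (fderiv ℝ g z)‖ ^ r) B₁ :=
            hcb.integrableOn_halfOpenBox _ _ _ _
          have hi2 : IntegrableOn (fun _ : ℂ => M ^ r) (B₂ \ B₁) :=
            integrableOn_const ((measure_mono Set.sdiff_subset).trans_lt
              (lt_top_iff_ne_top.2 (hfin _))).ne
          -- Pointwise: the derivative of g on the inner box, the uniform bound M on the layer, zero
          -- outside.
          calc ∫ z, ‖wirtingerBar (fderiv ℝ G z)‖ ^ r
              ≤ ∫ z, (B₁.indicator (fun z => ‖wirtingerBar (fderiv ℝ g z)‖ ^ r) z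
                + (B₂ \ B₁).indicator (fun _ => M ^ r) z) := by
                refine integral_mono hib ((hi1.integrable_indicator hB₁).add
                  (hi2.integrable_indicator (hB₂.diff hB₁))) fun z => ?_
                simp only
                by_cases h1 : z ∈ B₁
                · rw [Set.indicator_of_mem h1, Set.indicator_of_notMem (fun h => h.2 h1), hin z h1,
                    add_zero]
                · rw [Set.indicator_of_notMem h1, zero_add]
                  by_cases h2 : z ∈ B₂
                  · rw [Set.indicator_of_mem (show z ∈ B₂ \ B₁ from ⟨h2, h1⟩)]
                    have := (norm_wirtingerBar_le _).trans (hGb z)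
                    gcongr
                  · rw [Set.indicator_of_notMem (fun h => h2 h.1), hout z h2, wirtingerBar_zero,
                      hz0]
            _ = (2 * N : ℝ) ^ 2 * b + M ^ r * ((2 * N + 6) ^ 2 - (2 * N) ^ 2) := by
                rw [integral_add (hi1.integrable_indicator hB₁)
                  (hi2.integrable_indicator (hB₂.diff hB₁)), integral_indicator hB₁,
                  integral_indicator (hB₂.diff hB₁),
                  (hg.periodic_fderiv.comp_left fun L => ‖wirtingerBar L‖ ^ r).setIntegral_largeBox
                    hcb N, setIntegral_const, measureReal_sdiff hB hB₁ (hfin _), hv, hv]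
                push_cast
                simp only [smul_eq_mul]
                ring
  -- Division by (2N)²: ((2N + 6)² - (2N)²)/(2N)² = 6/N + 9/N².
  have hlim : Tendsto (fun N : ℕ => K * (b + M ^ r * (6 / N + 9 / (N : ℝ) ^ 2))) atTop
      (𝓝 (K * (b + M ^ r * (0 + 0)))) := by
    refine ((tendsto_const_nhds.mul (Tendsto.add ?_ ?_)).const_add b).const_mul K
    · exact tendsto_const_div_atTop_nhds_zero_nat 6
    · exact tendsto_const_nhds.div_atTop
        ((tendsto_pow_atTop two_ne_zero).comp tendsto_natCast_atTop_atTop)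
  have hfinal := ge_of_tendsto (b := a) hlim (by
    filter_upwards [eventually_gt_atTop 0] with N hN
    have hN' : (0 : ℝ) < N := by exact_mod_cast hN
    have h := key N
    have e : K * ((2 * N : ℝ) ^ 2 * b + M ^ r * ((2 * N + 6) ^ 2 - (2 * N) ^ 2))
        = (2 * N : ℝ) ^ 2 * (K * (b + M ^ r * (6 / N + 9 / (N : ℝ) ^ 2))) := by
      field_simp
      ring
    rw [e] at h
    exact le_of_mul_le_mul_left h (by positivity))
  simpa using hfinal

end IsPeriodicField

end PeriodicField
/-! ### Lamination of periodic functions -/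

section SquareIntegrals

variable {E : Type*} [NormedAddCommGroup E]

theorem Continuous.integrable_squareMeasure_prod {F : ℂ × ℂ → E} (hF : Continuous F) :
    Integrable F (squareMeasure.prod squareMeasure) := by
  rw [squareMeasure, Measure.prod_restrict, ← Measure.volume_eq_prod]
  have hc : IsCompact (Set.Icc (0 : ℝ) 1 ×ℂ Set.Icc (0 : ℝ) 1) :=
    isCompact_Icc.reProdIm isCompact_Icc
  have hs : halfOpenBox 0 1 0 1 ⊆ Set.Icc (0 : ℝ) 1 ×ℂ Set.Icc (0 : ℝ) 1 :=
    fun _ hz => ⟨Set.Ioc_subset_Icc_self hz.1, Set.Ioc_subset_Icc_self hz.2⟩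
  exact (hF.continuousOn.integrableOn_compact (hc.prod hc)).mono_set (Set.prod_mono hs hs)

variable [NormedSpace ℝ E]

theorem continuous_integral_squareMeasure {F : (ℝ × ℝ) × ℂ → E} (hF : Continuous F) :
    Continuous (fun a => ∫ w, F (a, w) ∂squareMeasure) := by
  have h : ∀ a, ∫ w, F (a, w) ∂squareMeasure
      = ∫ x in (0 : ℝ)..1, ∫ y in (0 : ℝ)..1, F (a, x + y * Complex.I) := fun a =>
    integral_squareMeasure (by fun_prop)
  simp_rw [h]
  apply intervalIntegral.continuous_parametric_intervalIntegral_of_continuous'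
  apply intervalIntegral.continuous_parametric_intervalIntegral_of_continuous'
    (f := fun (q : (ℝ × ℝ) × ℝ) (y : ℝ) => F (q.1, q.2 + y * Complex.I))
  unfold Function.uncurry
  fun_prop

/-- The linear form `m re z + n im z`. -/
noncomputable def latticeForm (m : ℤ) (n : ℕ) : ℂ →L[ℝ] ℝ :=
  (m : ℝ) • Complex.reCLM + (n : ℝ) • Complex.imCLM

theorem latticeForm_apply (m : ℤ) (n : ℕ) (z : ℂ) :
    latticeForm m n z = m * z.re + n * z.im := by
  simp [latticeForm]

theorem IsDoublyPeriodic.of_latticeForm {α : Type*} {η : ℝ → α} (hη : Function.Periodic η 1)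
    (m : ℤ) (n : ℕ) : IsDoublyPeriodic (fun z => η (latticeForm m n z)) := by
  refine ⟨fun z => ?_, fun z => ?_⟩
  · have := hη.int_mul m (latticeForm m n z)
    rw [← this]
    congr 1
    simp [latticeForm_apply]
    ring
  · have := hη.nat_mul n (latticeForm m n z)
    rw [← this]
    congr 1
    simp [latticeForm_apply]
    ring

/-- On each vertical segment of the unit square the form runs through exactly n periods, n ≠ 0, so
every inner integral is already the mean of η. -/
theorem integral_comp_latticeForm {η : ℝ → ℝ} (hη : Function.Periodic η 1) (hc : Continuous η)
    (m : ℤ) {n : ℕ} (hn : n ≠ 0) :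
    ∫ z, η (latticeForm m n z) ∂squareMeasure = ∫ t in (0 : ℝ)..1, η t := by
  rw [integral_squareMeasure (F := fun z => η (latticeForm m n z))
    (hc.comp (latticeForm m n).continuous)]
  have h : ∀ x : ℝ, ∫ y in (0 : ℝ)..1, η (latticeForm m n (x + y * Complex.I))
      = ∫ t in (0 : ℝ)..1, η t := by
    intro x
    have hn' : (n : ℝ) ≠ 0 := by exact_mod_cast hn
    have h1 : ∀ y : ℝ, latticeForm m n (x + y * Complex.I) = n * y + m * x := by
      intro y
      simp [latticeForm_apply]
      ring
    simp_rw [h1]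
    rw [intervalIntegral.integral_comp_mul_add _ hn']
    have h2 := hη.intervalIntegral_add_zsmul_eq n (m * x) fun a b => hc.intervalIntegrable a b
    rw [hη.intervalIntegral_add_eq (m * x) 0, zero_add, ← Int.cast_smul_eq_zsmul ℝ,
      ← Int.cast_smul_eq_zsmul ℝ] at h2
    simp only [smul_eq_mul, mul_one, Int.cast_natCast] at h2 ⊢
    rw [mul_zero, zero_add, add_comm (n : ℝ), h2, inv_mul_cancel_left₀ hn']
  simp_rw [h]
  simp

end SquareIntegrals

/-- The function `(a, b) ↦ ‖b‖^r - K ‖a‖^r`. -/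
noncomputable def powerDefect {X : Type u} [NormedAddCommGroup X] (r K : ℝ) (y : X × X) : ℝ := ‖y.2‖ ^ r - K * ‖y.1‖ ^ r

theorem continuous_powerDefect {X : Type u} [NormedAddCommGroup X] {r : ℝ} (hr : 0 < r) (K : ℝ) :
    Continuous (powerDefect r K : X × X → ℝ) := by
  unfold powerDefect
  exact (continuous_snd.norm.rpow_const fun _ => Or.inr hr.le).sub
    (continuous_const.mul (continuous_fst.norm.rpow_const fun _ => Or.inr hr.le))

/-! ### Plane waves and the gluing of periodic fields -/

section Lamination

variable {X : Type u} [NormedAddCommGroup X] [NormedSpace ℂ X]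

/-- With `wirtinger_smulRight`, this computes the two derivatives of a plane wave. Their ratio (m -
ni)/(m + ni) is the source of the multipliers on the circle. -/
theorem wirtingerBar_smulRight (α : ℝ) (m : ℤ) (n : ℕ) (x : X) :
    wirtingerBar ((α • latticeForm m n).smulRight x)
      = α • (((m + n * Complex.I) / 2 : ℂ) • x) := by
  simp only [wirtingerBar, ContinuousLinearMap.smulRight_apply, smul_apply, latticeForm_apply,
    ← Complex.coe_smul]
  simp
  module

theorem wirtinger_smulRight (α : ℝ) (m : ℤ) (n : ℕ) (x : X) :
    wirtinger ((α • latticeForm m n).smulRight x)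
      = α • (((m - n * Complex.I) / 2 : ℂ) • x) := by
  simp only [wirtinger, ContinuousLinearMap.smulRight_apply, smul_apply, latticeForm_apply,
    ← Complex.coe_smul]
  simp
  module

namespace IsPeriodicField

variable {g h : ℂ → X}

theorem add (hg : IsPeriodicField g) (hh : IsPeriodicField h) :
    IsPeriodicField (fun z => g z + h z) :=
  ⟨hg.contDiff.add hh.contDiff, ⟨fun z => by simp only [hg.periodic.1, hh.periodic.1],
    fun z => by simp only [hg.periodic.2, hh.periodic.2]⟩, hg.finiteDim.add hh.finiteDim⟩

theorem smul (hg : IsPeriodicField g) {c : ℂ → ℝ} (hc : ContDiff ℝ (⊤ : ℕ∞) c)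
    (hp : IsDoublyPeriodic c) : IsPeriodicField (fun z => c z • g z) :=
  ⟨hc.smul hg.contDiff, ⟨fun z => by simp only [hg.periodic.1, hp.1],
    fun z => by simp only [hg.periodic.2, hp.2]⟩, hg.finiteDim.smul c⟩

theorem const_smul {c : ℂ → ℝ} (hc : ContDiff ℝ (⊤ : ℕ∞) c)
    (hp : IsDoublyPeriodic c) (x : X) : IsPeriodicField (fun z => c z • x) :=
  ⟨hc.smul contDiff_const, ⟨fun z => by simp only [hp.1], fun z => by simp only [hp.2]⟩,
    hasFiniteDimRange_smul_const c x⟩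

/-- An integer frequency k preserves the period lattice. The factor 1/k leaves the size of the
derivative unchanged while the function itself becomes O(1/k). -/
theorem rescale (hg : IsPeriodicField g) (k : ℕ) (s : ℂ) :
    IsPeriodicField (fun z => (k : ℝ)⁻¹ • g (k * z + s)) := by
  refine ⟨contDiff_const.smul (hg.contDiff.comp ?_), ⟨fun z => ?_, fun z => ?_⟩,
    (hg.finiteDim.comp _).smul fun _ => (k : ℝ)⁻¹⟩
  · exact (contDiff_const.mul contDiff_id).add contDiff_const
  · have := hg.periodic.add_gaussianInt k 0 (k * z + s)
    rw [← this]
    congr 2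
    push_cast
    ring
  · have := hg.periodic.add_gaussianInt 0 k (k * z + s)
    rw [← this]
    congr 2
    push_cast
    ring

theorem hasFDerivAt_rescale (hg : IsPeriodicField g) {k : ℕ} (hk : k ≠ 0) (s z : ℂ) :
    HasFDerivAt (fun z => (k : ℝ)⁻¹ • g (k * z + s)) (fderiv ℝ g (k * z + s)) z := by
  have hk' : (k : ℝ) ≠ 0 := by exact_mod_cast hk
  have h1 : HasFDerivAt (fun z : ℂ => (k : ℂ) * z + s) ((k : ℝ) • ContinuousLinearMap.id ℝ ℂ) z := by
    have h2 := ((hasFDerivAt_id (𝕜 := ℝ) z).const_smul (k : ℝ)).add_const s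
    refine h2.congr_of_eventuallyEq (Eventually.of_forall fun w => ?_)
    simp
  have h3 := (((hg.differentiable (k * z + s)).hasFDerivAt.comp z h1).fun_const_smul (k : ℝ)⁻¹)
  refine h3.congr_fderiv ?_
  rw [ContinuousLinearMap.comp_smul, ContinuousLinearMap.comp_id, smul_smul,
    inv_mul_cancel₀ hk', one_smul]

end IsPeriodicField

/-- The pair of Wirtinger derivatives `(∂̄g, ∂g)`. -/
noncomputable def wirtingerPair (g : ℂ → X) (z : ℂ) : X × X :=
  (wirtingerBar (fderiv ℝ g z), wirtinger (fderiv ℝ g z))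

theorem IsPeriodicField.continuous_wirtingerPair {g : ℂ → X} (hg : IsPeriodicField g) :
    Continuous (wirtingerPair g) :=
  hg.continuous_bar.prodMk hg.continuous_wirtinger

theorem IsPeriodicField.periodic_wirtingerPair {g : ℂ → X} (hg : IsPeriodicField g) :
    IsDoublyPeriodic (wirtingerPair g) :=
  hg.periodic_fderiv.comp_left fun L => (wirtingerBar L, wirtinger L)

/-- The mean of `Φ (y + (∂̄g, ∂g))` over a period. -/
noncomputable def fieldEnergy (Φ : X × X → ℝ) (y : X × X) (g : ℂ → X) : ℝ :=
  ∫ z, Φ (y + wirtingerPair g z) ∂squareMeasure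

/-- The quotient `(m - n i) / (m + n i)`, a point of the unit circle. -/
noncomputable def circleQuotient (m : ℤ) (n : ℕ) : ℂ :=
  (m - n * Complex.I) / (m + n * Complex.I)

theorem add_mul_I_ne_zero (m : ℤ) {n : ℕ} (hn : n ≠ 0) : (m + n * Complex.I : ℂ) ≠ 0 := by
  intro h
  have := congrArg Complex.im h
  simp [hn] at this

/-- A plane wave with profile derivative χ - κ supplies the slow oscillation along (x, εx). The fast
copies of g₁ and g₂ are glued with weights χ and 1 - χ, and differentiating the weights costs only
the last term, of order 1/k. -/
theorem exists_laminate (m : ℤ) {n : ℕ} (hn : n ≠ 0) (x : X) {g₁ g₂ : ℂ → X}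
    (h₁ : IsPeriodicField g₁) (h₂ : IsPeriodicField g₂) {χ : ℝ → ℝ}
    (hχ : ContDiff ℝ (⊤ : ℕ∞) χ) (hp : Function.Periodic χ 1) {k : ℕ} (hk : k ≠ 0) (s : ℂ) :
    ∃ g : ℂ → X, IsPeriodicField g ∧ ∀ z, wirtingerPair g z
      = (χ (latticeForm m n z) - ∫ t in (0 : ℝ)..1, χ t) • (x, circleQuotient m n • x)
        + χ (latticeForm m n z) • wirtingerPair g₁ (k * z + s)
        + (1 - χ (latticeForm m n z)) • wirtingerPair g₂ (k * z + s)
        + ((k : ℝ)⁻¹ * deriv χ (latticeForm m n z)) •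
          (((m + n * Complex.I) / 2 : ℂ) • (g₁ (k * z + s) - g₂ (k * z + s)),
            ((m - n * Complex.I) / 2 : ℂ) • (g₁ (k * z + s) - g₂ (k * z + s))) := by
  set κ := ∫ t in (0 : ℝ)..1, χ t with hκ
  have hχd : ∀ t, HasDerivAt χ (deriv χ t) t := fun t =>
    (hχ.differentiable (by simp) t).hasDerivAt
  -- Subtracting the mean κ makes the antiderivative periodic.
  let H : ℝ → ℝ := fun t => ∫ s in (0 : ℝ)..t, (χ s - κ)
  have hcχ : Continuous (fun t => χ t - κ) := hχ.continuous.sub continuous_const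
  have hHd : ∀ t, HasDerivAt H (χ t - κ) t := fun t =>
    intervalIntegral.integral_hasDerivAt_right (hcχ.intervalIntegrable _ _)
      hcχ.aestronglyMeasurable.stronglyMeasurableAtFilter hcχ.continuousAt
  have hH : ContDiff ℝ (⊤ : ℕ∞) H := by
    rw [contDiff_infty_iff_deriv]
    refine ⟨fun t => (hHd t).differentiableAt, ?_⟩
    rw [show deriv H = fun t => χ t - κ from funext fun t => (hHd t).deriv]
    exact hχ.sub contDiff_const
  have hHp : Function.Periodic H 1 := by
    intro t
    have hper : Function.Periodic (fun t => χ t - κ) 1 := fun t => by simp only [hp t]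
    have h := hper.intervalIntegral_add_eq_add 0 t fun a b => hcχ.intervalIntegrable a b
    simp only [H]
    have h0 : ∫ t in (0 : ℝ)..1, (χ t - κ) = 0 := by
      rw [intervalIntegral.integral_sub (hχ.continuous.intervalIntegrable _ _)
        intervalIntegrable_const, ← hκ]
      simp
    rw [h, zero_add, h0, add_zero]
  have hL : ContDiff ℝ (⊤ : ℕ∞) (latticeForm m n) := (latticeForm m n).contDiff
  have hu := add_mul_I_ne_zero m hn
  -- Normalised so that ∂̄ of the plane wave points along x itself; ∂ then points along εx.
  let x' : X := (2 / (m + n * Complex.I) : ℂ) • x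
  let τ := latticeForm m n
  let w₁ : ℂ → X := fun z => (k : ℝ)⁻¹ • g₁ (k * z + s)
  let w₂ : ℂ → X := fun z => (k : ℝ)⁻¹ • g₂ (k * z + s)
  have hone : ContDiff ℝ (⊤ : ℕ∞) (fun t => 1 - χ t) := contDiff_const.sub hχ
  have hpone : Function.Periodic (fun t => 1 - χ t) 1 := fun t => by simp only [hp t]
  refine ⟨fun z => H (τ z) • x' + χ (τ z) • w₁ z + (1 - χ (τ z)) • w₂ z, ?_, fun z => ?_⟩
  · exact ((IsPeriodicField.const_smul (hH.comp hL) (.of_latticeForm hHp m n) x').add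
      ((h₁.rescale k s).smul (hχ.comp hL) (.of_latticeForm hp m n))).add
      ((h₂.rescale k s).smul (hone.comp hL) (.of_latticeForm hpone m n))
  · have d0 := ((hHd (τ z)).comp_hasFDerivAt z τ.hasFDerivAt).smul_const x'
    have d1 := ((hχd (τ z)).comp_hasFDerivAt z τ.hasFDerivAt).fun_smul
      (h₁.hasFDerivAt_rescale hk s z)
    have d2 := (((hχd (τ z)).const_sub 1).comp_hasFDerivAt z τ.hasFDerivAt).fun_smul
      (h₂.hasFDerivAt_rescale hk s z)
    have d := (d0.fun_add d1).fun_add d2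
    simp only [wirtingerPair]
    have e : fderiv ℝ (fun z => H (τ z) • x' + χ (τ z) • w₁ z + (1 - χ (τ z)) • w₂ z) z = _ :=
      d.fderiv
    rw [e]
    simp only [wirtingerBar_add, wirtingerBar_smul, wirtinger_add, wirtinger_smul, τ,
      wirtingerBar_smulRight, wirtinger_smulRight, Function.comp]
    have e1 : ((m + n * Complex.I) / 2 : ℂ) • x' = x := by
      rw [smul_smul]
      convert one_smul ℂ x using 2
      field_simp
    have e2 : ((m - n * Complex.I) / 2 : ℂ) • x' = circleQuotient m n • x := by
      rw [smul_smul, circleQuotient]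
      congr 1
      field_simp
    rw [e1, e2]
    apply Prod.ext
    · simp only [Prod.fst_add, Prod.smul_fst, ← Complex.coe_smul]
      push_cast
      module
    · simp only [Prod.snd_add, Prod.smul_snd, ← Complex.coe_smul]
      push_cast
      module

end Lamination
-- High-frequency limits and directional concavity of the energy
section Lamination

variable {X : Type u} [NormedAddCommGroup X] [NormedSpace ℂ X]

/-- Averaging over translations decouples the slow variable from the fast one. -/
theorem integral_le_of_forall_rescaled_le {J : (ℝ × ℝ) × ℂ → ℝ} (hJ : Continuous J)
    (hJw : ∀ a, IsDoublyPeriodic fun w => J (a, w))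
    (hJt : ∀ δ t w, J ((δ, t + 1), w) = J ((δ, t), w)) (m : ℤ) {n : ℕ} (hn : n ≠ 0) {B : ℝ}
    (hB : ∀ k : ℕ, k ≠ 0 → ∀ s : ℂ,
      ∫ z, J (((k : ℝ)⁻¹, latticeForm m n z), k * z + s) ∂squareMeasure ≤ B) :
    ∫ t in (0 : ℝ)..1, ∫ w, J ((0, t), w) ∂squareMeasure ≤ B := by
  let η : ℝ → ℝ → ℝ := fun δ t => ∫ w, J ((δ, t), w) ∂squareMeasure
  have hη : Continuous (Function.uncurry η) := continuous_integral_squareMeasure hJ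
  have hηc : ∀ δ, Continuous (η δ) := fun δ => hη.comp (Continuous.prodMk_right δ)
  have hηp : ∀ δ, Function.Periodic (η δ) 1 := by
    intro δ t
    simp only [η, hJt]
  have key : ∀ k : ℕ, k ≠ 0 → ∫ t in (0 : ℝ)..1, η (k : ℝ)⁻¹ t ≤ B := by
    intro k hk
    let F : ℂ × ℂ → ℝ := fun q => J (((k : ℝ)⁻¹, latticeForm m n q.2), q.1 + k * q.2)
    have hF : Continuous F :=
      hJ.comp ((continuous_const.prodMk ((latticeForm m n).continuous.comp continuous_snd)).prodMk
        (continuous_fst.add (continuous_const.mul continuous_snd)))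
    have hs : ∀ s, ∫ z, F (s, z) ∂squareMeasure ≤ B := by
      intro s
      refine le_of_eq_of_le ?_ (hB k hk s)
      simp only [F, add_comm s]
    have hint := hF.integrable_squareMeasure_prod
    calc ∫ t in (0 : ℝ)..1, η (k : ℝ)⁻¹ t
        = ∫ z, η (k : ℝ)⁻¹ (latticeForm m n z) ∂squareMeasure :=
          (integral_comp_latticeForm (η := η (k : ℝ)⁻¹) (hηp _) (hηc _) m hn).symm
      -- For fixed z, periodicity in the fast variable absorbs the translation by kz, so averaging
      -- over s frees the fast variable from z.
      _ = ∫ z, ∫ s, F (s, z) ∂squareMeasure ∂squareMeasure := by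
          congr 1
          ext z
          exact ((hJw ((k : ℝ)⁻¹, latticeForm m n z)).integral_add_right
            (hJ.comp (Continuous.prodMk_right _)) (k * z)).symm
      _ = ∫ s, ∫ z, F (s, z) ∂squareMeasure ∂squareMeasure :=
          (integral_integral_swap hint).symm
      _ ≤ ∫ _s, B ∂squareMeasure :=
          integral_mono hint.integral_prod_left (integrable_const _) hs
      _ = B := by simp
  have hlim : Tendsto (fun k : ℕ => ∫ t in (0 : ℝ)..1, η (k : ℝ)⁻¹ t) atTop
      (𝓝 (∫ t in (0 : ℝ)..1, η 0 t)) :=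
    ((intervalIntegral.continuous_parametric_intervalIntegral_of_continuous' hη 0 1).tendsto 0).comp
      tendsto_inv_atTop_nhds_zero_nat
  exact le_of_tendsto hlim (by
    filter_upwards [eventually_ne_atTop 0] with k hk
    exact key k hk)

/-- Averaging over the laminates of `exists_laminate`, in the limit of high frequencies. -/
theorem integral_laminate_le {Φ : X × X → ℝ} (hΦ : Continuous Φ) {y : X × X} {B : ℝ}
    (hB : ∀ g, IsPeriodicField g → fieldEnergy Φ y g ≤ B) (m : ℤ) {n : ℕ} (hn : n ≠ 0) (x : X)
    {g₁ g₂ : ℂ → X} (h₁ : IsPeriodicField g₁) (h₂ : IsPeriodicField g₂) {χ : ℝ → ℝ}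
    (hχ : ContDiff ℝ (⊤ : ℕ∞) χ) (hp : Function.Periodic χ 1) :
    ∫ t in (0 : ℝ)..1, ∫ w, Φ (y + ((χ t - ∫ t in (0 : ℝ)..1, χ t) • (x, circleQuotient m n • x)
      + χ t • wirtingerPair g₁ w + (1 - χ t) • wirtingerPair g₂ w)) ∂squareMeasure ≤ B := by
  set κ := ∫ t in (0 : ℝ)..1, χ t with hκ
  -- The slot `q.1.1` stands for 1/k; the limit at 0 erases the gluing error.
  let J : (ℝ × ℝ) × ℂ → ℝ := fun q => Φ (y + ((χ q.1.2 - κ) • (x, circleQuotient m n • x)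
      + χ q.1.2 • wirtingerPair g₁ q.2 + (1 - χ q.1.2) • wirtingerPair g₂ q.2
      + (q.1.1 * deriv χ q.1.2) •
          (((m + n * Complex.I) / 2 : ℂ) • (g₁ q.2 - g₂ q.2),
            ((m - n * Complex.I) / 2 : ℂ) • (g₁ q.2 - g₂ q.2))))
  have hJ : Continuous J := by
    have c1 := hχ.continuous
    have c2 := hχ.continuous_deriv (by simp)
    have c3 := h₁.continuous_wirtingerPair
    have c4 := h₂.continuous_wirtingerPair
    have c5 := h₁.contDiff.continuous
    have c6 := h₂.contDiff.continuous
    fun_prop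
  have hdp : Function.Periodic (deriv χ) 1 := by
    intro t
    rw [← deriv_comp_add_const]
    congr 1
    exact funext hp
  have hJw : ∀ a, IsDoublyPeriodic fun w => J (a, w) := fun a =>
    ⟨fun z => by
      simp only [J, h₁.periodic.1, h₂.periodic.1, h₁.periodic_wirtingerPair.1,
        h₂.periodic_wirtingerPair.1],
    fun z => by
      simp only [J, h₁.periodic.2, h₂.periodic.2, h₁.periodic_wirtingerPair.2,
        h₂.periodic_wirtingerPair.2]⟩
  have h := integral_le_of_forall_rescaled_le hJ hJw
    (fun δ t w => by simp only [J, hp t, hdp t]) m hn (B := B) fun k hk s => by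
      obtain ⟨g, hg, hgz⟩ := exists_laminate m hn x h₁ h₂ hχ hp hk s
      refine le_of_eq_of_le (integral_congr_ae (Eventually.of_forall fun z => ?_)) (hB g hg)
      simp only [J]
      rw [hgz]
  simpa only [J, zero_mul, zero_smul, add_zero] using h

/-- Smooth periodic approximations of the indicator of `[-λ/2, λ/2]` modulo one. -/
noncomputable def periodicStep (l : ℝ) (j : ℕ) (t : ℝ) : ℝ :=
  Real.smoothTransition (j * (Real.cos (2 * Real.pi * t) - Real.cos (Real.pi * l)))

theorem contDiff_periodicStep (l : ℝ) (j : ℕ) : ContDiff ℝ (⊤ : ℕ∞) (periodicStep l j) := by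
  have hs : ContDiff ℝ (⊤ : ℕ∞) Real.smoothTransition := Real.smoothTransition.contDiff
  refine hs.comp (contDiff_const.mul (ContDiff.sub ?_ contDiff_const))
  exact Real.contDiff_cos.comp (contDiff_const.mul contDiff_id)

theorem periodic_periodicStep (l : ℝ) (j : ℕ) : Function.Periodic (periodicStep l j) 1 := by
  intro t
  simp only [periodicStep]
  rw [mul_add, mul_one, Real.cos_add_two_pi]

theorem periodicStep_mem (l : ℝ) (j : ℕ) (t : ℝ) : periodicStep l j t ∈ Set.Icc (0 : ℝ) 1 :=
  ⟨Real.smoothTransition.nonneg _, Real.smoothTransition.le_one _⟩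

/-- On |t| ≤ 1/2, cos(2πt) > cos(πl) exactly when |t| < l/2. At equality the transition function is
evaluated at 0 and vanishes, whence the open interval. -/
theorem tendsto_periodicStep {l : ℝ} (hl : l ∈ Set.Icc (0 : ℝ) 1) {t : ℝ} (ht : |t| ≤ 1 / 2) :
    Tendsto (fun j => periodicStep l j t) atTop
      (𝓝 (Set.indicator (Set.Ioo (-(l / 2)) (l / 2)) (fun _ => 1) t)) := by
  have hpi := Real.pi_pos
  have hcos : Real.cos (2 * Real.pi * t) = Real.cos (2 * Real.pi * |t|) := by
    rw [← Real.cos_abs, abs_mul, abs_of_pos (by positivity : 0 < 2 * Real.pi)]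
  have hm1 : 2 * Real.pi * |t| ∈ Set.Icc 0 Real.pi := ⟨by positivity, by nlinarith⟩
  have hm2 : Real.pi * l ∈ Set.Icc 0 Real.pi := ⟨mul_nonneg hpi.le hl.1, by nlinarith [hl.2]⟩
  by_cases h : t ∈ Set.Ioo (-(l / 2)) (l / 2)
  · rw [Set.indicator_of_mem h]
    have h' : |t| < l / 2 := abs_lt.2 h
    have hlt : Real.cos (Real.pi * l) < Real.cos (2 * Real.pi * t) := by
      rw [hcos]
      exact Real.strictAntiOn_cos hm1 hm2 (by nlinarith)
    refine tendsto_const_nhds.congr' ?_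
    have h2 := (tendsto_natCast_atTop_atTop (R := ℝ)).atTop_mul_const (sub_pos.2 hlt)
    filter_upwards [h2.eventually_ge_atTop 1] with j hj
    exact (Real.smoothTransition.one_of_one_le hj).symm
  · rw [Set.indicator_of_notMem h]
    have h' : l / 2 ≤ |t| := by
      by_contra h2
      exact h (abs_lt.1 (not_le.1 h2))
    have hle : Real.cos (2 * Real.pi * t) ≤ Real.cos (Real.pi * l) := by
      rw [hcos]
      exact Real.strictAntiOn_cos.antitoneOn hm2 hm1 (by nlinarith)
    refine tendsto_const_nhds.congr fun j => ?_
    exact (Real.smoothTransition.zero_of_nonpos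
      (mul_nonpos_of_nonneg_of_nonpos (by positivity) (sub_nonpos.2 hle))).symm

/-- The limit step is 1 on a set of measure l and 0 on the rest of the period. The parameter κ is
present because the smooth steps have mean l only in the limit. -/
theorem tendsto_integral_periodicStep {f : ℝ × ℝ → ℝ} (hf : Continuous f) {l : ℝ}
    (hl : l ∈ Set.Icc (0 : ℝ) 1) {κ : ℕ → ℝ} (hκ : ∀ j, κ j ∈ Set.Icc (0 : ℝ) 1) {c : ℝ}
    (hc : Tendsto κ atTop (𝓝 c)) :
    Tendsto (fun j => ∫ t in (0 : ℝ)..1, f (periodicStep l j t, κ j)) atTop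
      (𝓝 (l * f (1, c) + (1 - l) * f (0, c))) := by
  have e : ∀ j, ∫ t in (0 : ℝ)..1, f (periodicStep l j t, κ j)
      = ∫ t in (-(1 / 2) : ℝ)..(1 / 2), f (periodicStep l j t, κ j) := by
    intro j
    have hp : Function.Periodic (fun t => f (periodicStep l j t, κ j)) 1 := fun t => by
      simp only [periodic_periodicStep l j t]
    have := hp.intervalIntegral_add_eq 0 (-(1 / 2))
    norm_num at this ⊢
    exact this
  simp_rw [e]
  obtain ⟨M, hM⟩ := (isCompact_Icc.prod isCompact_Icc :
    IsCompact (Set.Icc (0 : ℝ) 1 ×ˢ Set.Icc (0 : ℝ) 1)).exists_bound_of_continuousOn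
    hf.continuousOn
  let S := Set.Ioo (-(l / 2)) (l / 2)
  have hlim : l * f (1, c) + (1 - l) * f (0, c)
      = ∫ t in (-(1 / 2) : ℝ)..(1 / 2), f (S.indicator (fun _ => 1) t, c) := by
    have h1 : ∀ t, f (S.indicator (fun _ => 1) t, c)
        = S.indicator (fun _ => f (1, c) - f (0, c)) t + f (0, c) := by
      intro t
      by_cases ht : t ∈ S
      · simp only [Set.indicator_of_mem ht]
        ring
      · simp only [Set.indicator_of_notMem ht]
        ring
    simp_rw [h1]
    have hSs : S ⊆ Set.Ioc (-(1 / 2)) (1 / 2) := fun t ht =>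
      ⟨by linarith [ht.1, hl.2], by linarith [ht.2, hl.2]⟩
    have hi : IntegrableOn (S.indicator fun _ => f (1, c) - f (0, c)) (Set.Ioc (-(1 / 2)) (1 / 2))
        volume :=
      (integrableOn_const (by simp)).indicator measurableSet_Ioo
    rw [intervalIntegral.integral_of_le (by norm_num), integral_add hi (integrableOn_const (by simp)),
      setIntegral_indicator measurableSet_Ioo, Set.inter_eq_self_of_subset_right hSs,
      setIntegral_const, setIntegral_const, Real.volume_real_Ioo_of_le (by linarith [hl.1]),
      Real.volume_real_Ioc_of_le (by norm_num)]
    simp only [smul_eq_mul]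
    ring
  rw [hlim]
  refine intervalIntegral.tendsto_integral_filter_of_dominated_convergence (fun _ => M)
    ?_ ?_ (by simp) ?_
  · refine Eventually.of_forall fun j => Continuous.aestronglyMeasurable ?_
    exact hf.comp ((contDiff_periodicStep l j).continuous.prodMk continuous_const)
  · exact Eventually.of_forall fun j => Eventually.of_forall fun t _ =>
      hM _ ⟨periodicStep_mem l j t, hκ j⟩
  · refine Eventually.of_forall fun t ht => ?_
    rw [Set.uIoc_of_le (by norm_num)] at ht
    exact (hf.tendsto _).comp ((tendsto_periodicStep hl
      (abs_le.2 ⟨ht.1.le, ht.2⟩)).prodMk_nhds hc)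

/-- The supremum of the energies at `y` is concave in the directions `(x, ε x)`. -/
theorem convexComb_fieldEnergy_le {Φ : X × X → ℝ} (hΦ : Continuous Φ) {y : X × X} {B : ℝ}
    (hB : ∀ g, IsPeriodicField g → fieldEnergy Φ y g ≤ B) (m : ℤ) {n : ℕ} (hn : n ≠ 0) (x : X)
    {g₁ g₂ : ℂ → X} (h₁ : IsPeriodicField g₁) (h₂ : IsPeriodicField g₂) {l : ℝ}
    (hl : l ∈ Set.Icc (0 : ℝ) 1) :
    l * fieldEnergy Φ (y + (1 - l) • (x, circleQuotient m n • x)) g₁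
      + (1 - l) * fieldEnergy Φ (y - l • (x, circleQuotient m n • x)) g₂ ≤ B := by
  set v : X × X := (x, circleQuotient m n • x) with hv
  let J : (ℝ × ℝ) × ℂ → ℝ := fun q => Φ (y + ((q.1.1 - q.1.2) • v
      + q.1.1 • wirtingerPair g₁ q.2 + (1 - q.1.1) • wirtingerPair g₂ q.2))
  have hJ : Continuous J := by
    have c3 := h₁.continuous_wirtingerPair
    have c4 := h₂.continuous_wirtingerPair
    fun_prop
  have hf := continuous_integral_squareMeasure hJ
  let κ : ℕ → ℝ := fun j => ∫ t in (0 : ℝ)..1, periodicStep l j t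
  have hκm : ∀ j, κ j ∈ Set.Icc (0 : ℝ) 1 := by
    intro j
    have hc : IntervalIntegrable (periodicStep l j) volume 0 1 :=
      (contDiff_periodicStep l j).continuous.intervalIntegrable _ _
    constructor
    · exact intervalIntegral.integral_nonneg zero_le_one fun t _ => (periodicStep_mem l j t).1
    · have := intervalIntegral.integral_mono (g := fun _ => (1 : ℝ)) zero_le_one hc
        intervalIntegrable_const fun t => (periodicStep_mem l j t).2
      simpa using this
  have hκl : Tendsto κ atTop (𝓝 l) := by
    have := tendsto_integral_periodicStep (f := Prod.fst) continuous_fst hl (κ := fun _ => 0)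
      (fun _ => by simp) tendsto_const_nhds
    simpa using this
  -- In the limit κ = l: the phase χ = 1 sits at y + (1 - l)v and carries g₁, the phase χ = 0 sits
  -- at y - lv and carries g₂.
  have hlim := tendsto_integral_periodicStep hf hl hκm hκl
  have h := le_of_tendsto' hlim fun j =>
    integral_laminate_le hΦ hB m hn x h₁ h₂ (contDiff_periodicStep l j) (periodic_periodicStep l j)
  simp only [J, fieldEnergy] at h ⊢
  simpa [← add_assoc, sub_eq_add_neg] using h

end Lamination
-- The concave majorant
section Majorant

variable {X : Type u} [NormedAddCommGroup X] [NormedSpace ℂ X]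

theorem wirtingerPair_const_smul {g : ℂ → X} (hg : IsPeriodicField g) (c : ℝ) (z : ℂ) :
    wirtingerPair (fun z => c • g z) z = c • wirtingerPair g z := by
  have h : fderiv ℝ (fun z => c • g z) z = c • fderiv ℝ g z :=
    ((hg.differentiable z).hasFDerivAt.fun_const_smul c).fderiv
  simp only [wirtingerPair, h, wirtingerBar_smul, wirtinger_smul, Prod.smul_mk]

theorem fieldEnergy_zero (Φ : X × X → ℝ) (y : X × X) : fieldEnergy Φ y (fun _ => 0) = Φ y := by
  have h : ∀ z, wirtingerPair (fun _ => (0 : X)) z = 0 := fun z => by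
    simp [wirtingerPair]
  simp [fieldEnergy, h]

/-- Midpoint concavity, with the zero field at the reflected point, carries a bound at y to a bound
at the neighbour y + (x, εx). -/
theorem fieldEnergy_bounded_add {Φ : X × X → ℝ} (hΦ : Continuous Φ) {y : X × X} {B : ℝ}
    (hB : ∀ g, IsPeriodicField g → fieldEnergy Φ y g ≤ B) (m : ℤ) {n : ℕ} (hn : n ≠ 0) (x : X)
    {g : ℂ → X} (hg : IsPeriodicField g) :
    fieldEnergy Φ (y + (x, circleQuotient m n • x)) g
      ≤ 2 * B - Φ (y - (x, circleQuotient m n • x)) := by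
  have h := convexComb_fieldEnergy_le hΦ hB m hn ((2 : ℝ) • x) hg isPeriodicField_zero
    (l := 1 / 2) (by norm_num)
  have e : ((2 : ℝ) • x, circleQuotient m n • (2 : ℝ) • x)
      = (2 : ℝ) • (x, circleQuotient m n • x) := by
    rw [Prod.smul_mk, smul_comm]
  rw [fieldEnergy_zero, e, smul_smul, smul_smul] at h
  norm_num at h
  linarith

/-- The directions (x, -x) and (x, -ix) together span X × X, so two applications of
`fieldEnergy_bounded_add` lead from the origin to any y. Hence the supremum defining the majorant is
finite. -/
theorem exists_fieldEnergy_bound {Φ : X × X → ℝ} (hΦ : Continuous Φ)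
    (h0 : ∀ g, IsPeriodicField g → fieldEnergy Φ 0 g ≤ 0) (y : X × X) :
    ∃ B, ∀ g, IsPeriodicField g → fieldEnergy Φ y g ≤ B := by
  have q1 : circleQuotient 0 1 = -1 := by simp [circleQuotient]
  have q2 : circleQuotient 1 1 = -Complex.I := by
    have : (1 + Complex.I : ℂ) ≠ 0 := by
      intro h
      have := congrArg Complex.im h
      simp at this
    simp only [circleQuotient]
    push_cast
    rw [one_mul, div_eq_iff this]
    linear_combination Complex.I_sq
  have hi : (1 - Complex.I : ℂ) ≠ 0 := by
    intro h
    have := congrArg Complex.im h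
    simp at this
  -- Solution of x₁ + x₂ = y.1 and -x₁ - ix₂ = y.2: adding the equations eliminates x₁.
  let x₂ : X := (1 - Complex.I)⁻¹ • (y.1 + y.2)
  have hx₂ : (1 - Complex.I) • x₂ = y.1 + y.2 := by rw [smul_smul, mul_inv_cancel₀ hi, one_smul]
  let x₁ : X := y.1 - x₂
  have h1 := fun g hg => fieldEnergy_bounded_add hΦ h0 0 one_ne_zero x₁ (g := g) hg
  refine ⟨2 * (2 * 0 - Φ (0 - (x₁, circleQuotient 0 1 • x₁)))
    - Φ (0 + (x₁, circleQuotient 0 1 • x₁) - (x₂, circleQuotient 1 1 • x₂)), fun g hg => ?_⟩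
  have h2 := fieldEnergy_bounded_add hΦ h1 1 one_ne_zero x₂ (g := g) hg
  have e : 0 + (x₁, circleQuotient 0 1 • x₁) + (x₂, circleQuotient 1 1 • x₂) = y := by
    rw [q1, q2, zero_add]
    apply Prod.ext
    · simp [x₁]
    · have : y.2 = (1 - Complex.I) • x₂ - y.1 := by rw [hx₂]; abel
      simp only [Prod.mk_add_mk, x₁, this]
      module
  rwa [e] at h2

/-- If all energies at the origin are nonpositive, then `Φ` has a majorant that is concave in the
directions `(x, ε x)` and nonpositive at the points `(x, ε x)`. -/
theorem exists_concave_majorant {Φ : X × X → ℝ} (hΦ : Continuous Φ) (hneg : ∀ y, Φ (-y) = Φ y)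
    (h0 : ∀ g, IsPeriodicField g → fieldEnergy Φ 0 g ≤ 0) :
    ∃ U : X × X → ℝ, (∀ y, Φ y ≤ U y) ∧
      (∀ (m : ℤ) (n : ℕ), n ≠ 0 → ∀ y,
        ConcaveOn ℝ Set.univ fun x => U (y + (x, circleQuotient m n • x))) ∧
      ∀ (m : ℤ) (n : ℕ), n ≠ 0 → ∀ x, U (x, circleQuotient m n • x) ≤ 0 := by
  let S := {g : ℂ → X // IsPeriodicField g}
  let U : X × X → ℝ := fun y => ⨆ g : S, fieldEnergy Φ y g.1
  have : Nonempty S := ⟨⟨_, isPeriodicField_zero⟩⟩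
  have hbdd : ∀ y, BddAbove (Set.range fun g : S => fieldEnergy Φ y g.1) := by
    intro y
    obtain ⟨B, hB⟩ := exists_fieldEnergy_bound hΦ h0 y
    exact ⟨B, by rintro _ ⟨g, rfl⟩; exact hB _ g.2⟩
  have hle : ∀ y g, IsPeriodicField g → fieldEnergy Φ y g ≤ U y := fun y g hg =>
    le_ciSup (hbdd y) ⟨g, hg⟩
  refine ⟨U, fun y => ?_, fun m n hn y => ?_, fun m n hn x => ?_⟩
  · rw [← fieldEnergy_zero Φ y]
    exact hle y _ isPeriodicField_zero
  · rw [concaveOn_iff_forall_pos]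
    refine ⟨convex_univ, fun x₁ _ x₂ _ a b ha hb hab => ?_⟩
    set ε := circleQuotient m n
    set w := y + (a • x₁ + b • x₂, ε • (a • x₁ + b • x₂)) with hw
    have key : ∀ g₁ g₂ : S, a * fieldEnergy Φ (y + (x₁, ε • x₁)) g₁.1
        + b * fieldEnergy Φ (y + (x₂, ε • x₂)) g₂.1 ≤ U w := by
      intro g₁ g₂
      have h := convexComb_fieldEnergy_le hΦ (hle w) m hn (x₁ - x₂) g₁.2 g₂.2 (l := a)
        ⟨ha.le, by linarith⟩
      have hb' : b = 1 - a := by linarith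
      have e1 : w + (1 - a) • (x₁ - x₂, ε • (x₁ - x₂)) = y + (x₁, ε • x₁) := by
        apply Prod.ext <;>
          simp only [hw, hb', Prod.fst_add, Prod.snd_add, Prod.smul_fst, Prod.smul_snd,
            ← Complex.coe_smul] <;> push_cast <;> module
      have e2 : w - a • (x₁ - x₂, ε • (x₁ - x₂)) = y + (x₂, ε • x₂) := by
        apply Prod.ext <;>
          simp only [hw, hb', Prod.fst_add, Prod.snd_add, Prod.fst_sub, Prod.snd_sub,
            Prod.smul_fst, Prod.smul_snd, ← Complex.coe_smul] <;> push_cast <;> module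
      rw [e1, e2] at h
      rwa [hb']
    simp only [smul_eq_mul]
    have h1 : ∀ g₂ : S, a * U (y + (x₁, ε • x₁))
        + b * fieldEnergy Φ (y + (x₂, ε • x₂)) g₂.1 ≤ U w := by
      intro g₂
      rw [← le_sub_iff_add_le, ← le_div_iff₀' ha]
      refine ciSup_le fun g₁ => ?_
      rw [le_div_iff₀' ha, le_sub_iff_add_le]
      exact key g₁ g₂
    rw [← le_sub_iff_add_le', ← le_div_iff₀' hb]
    refine ciSup_le fun g₂ => ?_
    rw [le_div_iff₀' hb, le_sub_iff_add_le']
    exact h1 g₂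
  · refine ciSup_le fun g => ?_
    -- As Φ is even, -g has at -(x, εx) the same energy as g at (x, εx); the midpoint of these
    -- points is the origin, where energies are nonpositive.
    have hg' : IsPeriodicField (fun z => (-1 : ℝ) • g.1 z) :=
      g.2.smul contDiff_const ⟨fun _ => rfl, fun _ => rfl⟩
    have h := convexComb_fieldEnergy_le hΦ h0 m hn ((2 : ℝ) • x) g.2 hg'
      (l := 1 / 2) (by norm_num)
    have e : ((2 : ℝ) • x, circleQuotient m n • (2 : ℝ) • x)
        = (2 : ℝ) • (x, circleQuotient m n • x) := by
      rw [Prod.smul_mk, smul_comm]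
    have e' : fieldEnergy Φ (-(x, circleQuotient m n • x)) (fun z => (-1 : ℝ) • g.1 z)
        = fieldEnergy Φ (x, circleQuotient m n • x) g.1 := by
      simp only [fieldEnergy, wirtingerPair_const_smul g.2]
      congr 1
      ext z
      rw [neg_one_smul, ← neg_add, hneg]
    rw [e, smul_smul, smul_smul, zero_add, zero_sub] at h
    norm_num at h
    norm_num at e'
    rw [e'] at h
    linarith

end Majorant
/-! ### Simple martingale differences -/

section SimpleMartingales

variable {Ω : Type v} {mΩ : MeasurableSpace Ω} {μ : Measure Ω} {β : Type*} {γ : Type*}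

theorem MeasureTheory.SimpleFunc.integral_eq_sum_fibers {E : Type*} [NormedAddCommGroup E]
    [NormedSpace ℝ E] (S : SimpleFunc Ω β) {F : Ω → E} (hF : Integrable F μ) :
    ∫ ω, F ω ∂μ = ∑ v ∈ S.range, ∫ ω in S ⁻¹' {v}, F ω ∂μ := by
  have hU : ⋃ v ∈ S.range, S ⁻¹' {v} = Set.univ := by
    ext ω
    simp
  rw [← integral_biUnion_finset _ (fun v _ => S.measurableSet_fiber v) ?_
    (fun v _ => hF.integrableOn), hU, setIntegral_univ]
  intro v _ w _ hvw
  exact Disjoint.preimage _ (Set.disjoint_singleton.2 hvw)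

theorem MeasureTheory.SimpleFunc.integrable_comp [IsFiniteMeasure μ] {E : Type*}
    [NormedAddCommGroup E] (S : SimpleFunc Ω β) (φ : β → E) :
    Integrable (fun ω => φ (S ω)) μ :=
  (S.map φ).integrable_of_isFiniteMeasure

theorem MeasureTheory.SimpleFunc.integral_comp [IsFiniteMeasure μ] {E : Type*}
    [NormedAddCommGroup E] [NormedSpace ℝ E] [CompleteSpace E] (S : SimpleFunc Ω β) (φ : β → E) :
    ∫ ω, φ (S ω) ∂μ = ∑ v ∈ S.range, μ.real (S ⁻¹' {v}) • φ v := by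
  rw [S.integral_eq_sum_fibers (S.integrable_comp φ)]
  refine Finset.sum_congr rfl fun v _ => ?_
  rw [← setIntegral_const]
  exact setIntegral_congr_fun (S.measurableSet_fiber v) fun ω hω => by
    simp only [show S ω = v from hω]

/-- The simple function recording the first `k` values of the sequence `g`. -/
noncomputable def history (g : ℕ → SimpleFunc Ω γ) : ℕ → SimpleFunc Ω (List γ)
  | 0 => SimpleFunc.const Ω []
  | k + 1 => ((g k).pair (history g k)).map fun q => q.1 :: q.2

theorem history_succ_apply (g : ℕ → SimpleFunc Ω γ) (k : ℕ) (ω : Ω) :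
    history g (k + 1) ω = g k ω :: history g k ω := rfl

variable {X : Type u} [NormedAddCommGroup X] [NormedSpace ℂ X]

/-- The averages of `g` over the fibers of `G`. -/
noncomputable def fiberAverage (μ : Measure Ω) (G : SimpleFunc Ω β) (g : Ω → X) (v : β) : X :=
  (μ.real (G ⁻¹' {v}))⁻¹ • ∫ ω in G ⁻¹' {v}, g ω ∂μ

/-- Subtracting the averages over the fibers of the history makes `g` a difference sequence. -/
noncomputable def centered (μ : Measure Ω) (g : ℕ → SimpleFunc Ω X) : ℕ → SimpleFunc Ω X
  | 0 => g 0
  | k + 1 => g (k + 1)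
      - (history g (k + 1)).map (fiberAverage μ (history g (k + 1)) (g (k + 1)))

/-- Both partial sums are determined by the history, hence constant on its fibers. On each fiber the
next step therefore starts from a fixed point in a fixed direction. -/
theorem exists_sum_centered_eq (g : ℕ → SimpleFunc Ω X) (ε : ℕ → ℂ) (k : ℕ) :
    ∃ P : List X → X × X, ∀ ω, (∑ i ∈ Finset.range k, centered μ g i ω,
      ∑ i ∈ Finset.range k, ε i • centered μ g i ω) = P (history g k ω) := by
  induction k with
  | zero => exact ⟨fun _ => 0, fun ω => by simp⟩
  | succ k ih =>
    obtain ⟨P, hP⟩ := ih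
    obtain ⟨c, hc⟩ : ∃ c : X → List X → X, ∀ ω, centered μ g k ω = c (g k ω) (history g k ω) := by
      cases k with
      | zero => exact ⟨fun x _ => x, fun ω => rfl⟩
      | succ k =>
        exact ⟨fun x l => x - fiberAverage μ (history g (k + 1)) (g (k + 1)) l, fun ω => rfl⟩
    -- The head of the list is the newest value; a nonempty history never meets the empty case.
    refine ⟨fun l => match l with
      | [] => 0
      | x :: l => P l + (c x l, ε k • c x l), fun ω => ?_⟩
    rw [history_succ_apply, Finset.sum_range_succ, Finset.sum_range_succ]
    simp only
    rw [← hP ω, hc ω, Prod.mk_add_mk]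

variable [CompleteSpace X]

/-- Conditional Jensen inequality for simple functions. -/
theorem integral_concave_comp_le [IsFiniteMeasure μ] (G : SimpleFunc Ω β) (e : SimpleFunc Ω X)
    (hmean : ∀ v, ∫ ω in G ⁻¹' {v}, e ω ∂μ = 0) {w : β → X → ℝ}
    (hw : ∀ v, ConcaveOn ℝ Set.univ (w v)) :
    ∫ ω, w (G ω) (e ω) ∂μ ≤ ∫ ω, w (G ω) 0 ∂μ := by
  rw [G.integral_eq_sum_fibers (F := fun ω => w (G ω) (e ω))
      ((G.pair e).integrable_comp fun q => w q.1 q.2),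
    G.integral_eq_sum_fibers (G.integrable_comp fun v => w v 0)]
  refine Finset.sum_le_sum fun v _ => ?_
  have e1 : ∫ ω in G ⁻¹' {v}, w (G ω) (e ω) ∂μ = ∫ ω in G ⁻¹' {v}, w v (e ω) ∂μ :=
    setIntegral_congr_fun (G.measurableSet_fiber v) fun ω hω => by
      simp only [show G ω = v from hω]
  have e2 : ∫ ω in G ⁻¹' {v}, w (G ω) 0 ∂μ = ∫ ω in G ⁻¹' {v}, w v 0 ∂μ :=
    setIntegral_congr_fun (G.measurableSet_fiber v) fun ω hω => by
      simp only [show G ω = v from hω]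
  have e3 := hmean v
  rw [e1, e2, e.integral_comp (fun x => w v x)]
  rw [e.integral_comp (fun x => x)] at e3
  have e4 : ∫ ω in G ⁻¹' {v}, w v 0 ∂μ
      = ∑ x ∈ e.range, (μ.restrict (G ⁻¹' {v})).real (e ⁻¹' {x}) • w v 0 :=
    e.integral_comp (fun _ => w v 0)
  rw [e4, ← Finset.sum_smul]
  set p : X → ℝ := fun x => (μ.restrict (G ⁻¹' {v})).real (e ⁻¹' {x}) with hp
  have hp0 : ∀ x ∈ e.range, 0 ≤ p x := fun x _ => measureReal_nonneg
  -- On a null fiber both sides vanish; otherwise this is finite Jensen with barycentre 0 by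
  -- `hmean`.
  rcases (Finset.sum_nonneg hp0).eq_or_lt with h0 | h0
  · have h0' := (Finset.sum_eq_zero_iff_of_nonneg hp0).1 h0.symm
    rw [← h0, zero_smul]
    exact (Finset.sum_eq_zero fun x hx => by
      change p x • w v x = 0
      rw [h0' x hx, zero_smul]).le
  · have h := (hw v).le_map_centerMass (t := e.range) (p := fun x => x) hp0 h0
      (fun _ _ => Set.mem_univ _)
    rw [Finset.centerMass, Finset.centerMass, e3, smul_zero, smul_eq_mul, inv_mul_le_iff₀ h0] at h
    exact h

theorem setIntegral_fiberAverage [IsFiniteMeasure μ] (G : SimpleFunc Ω β) (g : Ω → X) (v : β) :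
    ∫ ω in G ⁻¹' {v}, fiberAverage μ G g (G ω) ∂μ = ∫ ω in G ⁻¹' {v}, g ω ∂μ := by
  have e1 : ∫ ω in G ⁻¹' {v}, fiberAverage μ G g (G ω) ∂μ
      = ∫ ω in G ⁻¹' {v}, fiberAverage μ G g v ∂μ :=
    setIntegral_congr_fun (G.measurableSet_fiber v) fun ω hω => by
      simp only [show G ω = v from hω]
  rw [e1, setIntegral_const, fiberAverage, smul_smul]
  by_cases h : μ.real (G ⁻¹' {v}) = 0
  · have h' : μ (G ⁻¹' {v}) = 0 := (measureReal_eq_zero_iff).1 h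
    rw [setIntegral_measure_zero _ h', smul_zero]
  · rw [mul_inv_cancel₀ h, one_smul]

/-- As d has mean zero on the fibers, averaging g there is the conditional expectation of g - d, and
conditional expectation contracts L^p. Thus the correction that centers an approximation of d is as
small as the approximation error. -/
theorem eLpNorm_fiberAverage_le [IsProbabilityMeasure μ] {p : ℝ≥0∞} (hp : 1 ≤ p)
    (G : SimpleFunc Ω β) {g d : Ω → X} (hg : Integrable g μ) (hd : Integrable d μ)
    (hd0 : ∀ v, ∫ ω in G ⁻¹' {v}, d ω ∂μ = 0) :
    eLpNorm (fun ω => fiberAverage μ G g (G ω)) p μ ≤ eLpNorm (g - d) p μ := by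
  have hm : MeasurableSpace.comap G ⊤ ≤ mΩ := by
    rintro s ⟨T, -, rfl⟩
    exact G.measurableSet_preimage T
  have hint : Integrable (fun ω => fiberAverage μ G g (G ω)) μ := G.integrable_comp _
  have hsm : StronglyMeasurable[MeasurableSpace.comap G ⊤] (fun ω => fiberAverage μ G g (G ω)) := by
    let S : @SimpleFunc Ω (MeasurableSpace.comap G ⊤) X := @SimpleFunc.mk Ω (MeasurableSpace.comap G ⊤) X (fun ω => fiberAverage μ G g (G ω))
      (fun x => ⟨fiberAverage μ G g ⁻¹' {x}, trivial, rfl⟩)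
      ((G.finite_range.image (fiberAverage μ G g)).subset (by
        rintro _ ⟨ω, rfl⟩
        exact ⟨G ω, ⟨ω, rfl⟩, rfl⟩))
    exact S.stronglyMeasurable
  have h := ae_eq_condExp_of_forall_setIntegral_eq hm (hg.sub hd)
    (g := fun ω => fiberAverage μ G g (G ω)) (fun s _ _ => hint.integrableOn) (by
      rintro s ⟨T, -, rfl⟩ -
      rw [G.integral_eq_sum_fibers hint.integrableOn,
        G.integral_eq_sum_fibers (hg.sub hd).integrableOn]
      refine Finset.sum_congr rfl fun v _ => ?_
      rw [Measure.restrict_restrict (G.measurableSet_fiber v)]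
      by_cases hv : v ∈ T
      · have : G ⁻¹' {v} ∩ G ⁻¹' T = G ⁻¹' {v} :=
          Set.inter_eq_left.2 (Set.preimage_mono (Set.singleton_subset_iff.2 hv))
        rw [this, setIntegral_fiberAverage]
        simp only [Pi.sub_apply]
        rw [integral_sub hg.integrableOn hd.integrableOn, hd0, sub_zero]
      · have : G ⁻¹' {v} ∩ G ⁻¹' T = ∅ := by
          rw [← Set.preimage_inter, Set.singleton_inter_eq_empty.2 hv, Set.preimage_empty]
        rw [this]
        simp) hsm.aestronglyMeasurable
  rw [eLpNorm_congr_ae h]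
  exact eLpNorm_condExp_le_eLpNorm _ hp

theorem setIntegral_centered [IsFiniteMeasure μ] (g : ℕ → SimpleFunc Ω X) (k : ℕ) (l : List X) :
    ∫ ω in history g (k + 1) ⁻¹' {l}, centered μ g (k + 1) ω ∂μ = 0 := by
  simp only [centered, SimpleFunc.coe_sub, Pi.sub_apply, SimpleFunc.map_apply]
  rw [integral_sub (g (k + 1)).integrable_of_isFiniteMeasure.integrableOn
    ((history g (k + 1)).integrable_comp _).integrableOn, setIntegral_fiberAverage, sub_self]

/-- A function that is concave in the directions `(x, ε_k x)` decreases in mean along the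
transformed sequence. -/
theorem integral_centered_le_zero [IsProbabilityMeasure μ] (g : ℕ → SimpleFunc Ω X) {ε : ℕ → ℂ}
    {U : X × X → ℝ} (hU : ∀ k y, ConcaveOn ℝ Set.univ fun x => U (y + (x, ε k • x)))
    (hU0 : ∀ k x, U (x, ε k • x) ≤ 0) (k : ℕ) :
    ∫ ω, U (∑ i ∈ Finset.range (k + 1), centered μ g i ω,
      ∑ i ∈ Finset.range (k + 1), ε i • centered μ g i ω) ∂μ ≤ 0 := by
  induction k with
  | zero =>
    refine integral_nonpos fun ω => ?_
    simpa using hU0 0 (centered μ g 0 ω)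
  | succ k ih =>
    obtain ⟨P, hP⟩ := exists_sum_centered_eq (μ := μ) g ε (k + 1)
    refine le_trans ?_ ih
    have h := integral_concave_comp_le (μ := μ) (history g (k + 1)) (centered μ g (k + 1))
      (setIntegral_centered g k) (w := fun l x => U (P l + (x, ε (k + 1) • x)))
      (fun l => hU (k + 1) (P l))
    simp only [← hP, smul_zero, Prod.mk_zero_zero, add_zero, Prod.mk_add_mk] at h
    simp only [Finset.sum_range_succ _ (k + 1)]
    exact h

end SimpleMartingales
/-! ### Approximation of martingale differences -/

section Approximation

variable {Ω : Type v} {mΩ : MeasurableSpace Ω} {μ : Measure Ω}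

theorem measurableSet_history_fiber (ℱ : Filtration ℕ mΩ) {γ : Type*} {g : ℕ → SimpleFunc Ω γ}
    (hg : ∀ k x, MeasurableSet[ℱ k] (g k ⁻¹' {x})) (k : ℕ) (l : List γ) :
    MeasurableSet[ℱ k] (history g (k + 1) ⁻¹' {l}) := by
  have hcons : ∀ k x l, history g (k + 1) ⁻¹' {x :: l} = g k ⁻¹' {x} ∩ history g k ⁻¹' {l} := by
    intro k x l
    ext ω
    simp [history_succ_apply]
  have hnil : ∀ k, history g (k + 1) ⁻¹' {[]} = ∅ := by
    intro k
    ext ω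
    simp [history_succ_apply]
  induction k generalizing l with
  | zero =>
    cases l with
    | nil => rw [hnil]; exact @MeasurableSet.empty _ (_)
    | cons x l =>
      rw [hcons]
      refine (hg 0 x).inter ?_
      have : history g 0 ⁻¹' {l} = Set.univ ∨ history g 0 ⁻¹' {l} = ∅ := by
        by_cases h : l = []
        · left
          ext ω
          simp [history, h]
        · right
          ext ω
          simp [history, Ne.symm h]
      rcases this with h | h <;> rw [h]
      · exact @MeasurableSet.univ _ (_)
      · exact @MeasurableSet.empty _ (_)
  | succ k ih =>
    cases l with
    | nil => rw [hnil]; exact @MeasurableSet.empty _ (_)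
    | cons x l =>
      rw [hcons]
      exact (hg (k + 1) x).inter (ℱ.mono (Nat.le_succ k) _ (ih l))

variable {X : Type u} [NormedAddCommGroup X] [NormedSpace ℂ X] [CompleteSpace X]

namespace IsLpMartingaleDifference

variable {p : ℝ≥0∞} {ℱ : Filtration ℕ mΩ} {d : ℕ → Ω → X}

theorem stronglyMeasurable (hd : IsLpMartingaleDifference p μ ℱ d) (k : ℕ) :
    StronglyMeasurable[ℱ k] (d k) := by
  have h := hd.martingale.1
  cases k with
  | zero => simpa using h 0
  | succ k =>
    have h1 := (h (k + 1)).sub ((h k).mono (ℱ.mono (Nat.le_succ k)))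
    convert h1 using 1
    ext ω
    simp [Finset.sum_range_succ _ (k + 1)]

theorem setIntegral_eq_zero [IsProbabilityMeasure μ] (hp : 1 ≤ p)
    (hd : IsLpMartingaleDifference p μ ℱ d) (k : ℕ) {s : Set Ω} (hs : MeasurableSet[ℱ k] s) :
    ∫ ω in s, d (k + 1) ω ∂μ = 0 := by
  have h := hd.martingale.setIntegral_eq (Nat.le_succ k) hs
  have hi : ∀ i, Integrable (d i) μ := fun i => (hd.memLp i).integrable hp
  have hsum : Integrable (fun ω => ∑ i ∈ Finset.range (k + 1), d i ω) μ :=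
    integrable_finsetSum _ fun i _ => hi i
  simp only [Nat.succ_eq_add_one, Finset.sum_range_succ _ (k + 1)] at h
  rw [integral_add hsum.integrableOn (hi _).integrableOn] at h
  exact left_eq_add.1 h

/-- Approximating with respect to the measure trimmed to ℱ_k keeps the approximant adapted. -/
theorem exists_simple_approx [IsProbabilityMeasure μ] (hp' : p ≠ ∞)
    (hd : IsLpMartingaleDifference p μ ℱ d) {δ : ℝ≥0∞} (hδ : δ ≠ 0) (k : ℕ) :
    ∃ g : SimpleFunc Ω X, (∀ x, MeasurableSet[ℱ k] (g ⁻¹' {x})) ∧ eLpNorm (⇑g - d k) p μ ≤ δ := by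
  have hsm := hd.stronglyMeasurable k
  have hm : MemLp (d k) p (μ.trim (ℱ.le k)) := by
    refine ⟨hsm.aestronglyMeasurable, ?_⟩
    rw [eLpNorm_trim (ℱ.le k) hsm]
    exact (hd.memLp k).2
  obtain ⟨g, hg, -⟩ := @MemLp.exists_simpleFunc_eLpNorm_sub_lt Ω (ℱ k) p X _ (d k) _ hm hp' _ hδ
  refine ⟨g.toLargerSpace (ℱ.le k), fun x => @SimpleFunc.measurableSet_fiber _ _ (ℱ k) g x, ?_⟩
  rw [SimpleFunc.coe_toLargerSpace_eq, eLpNorm_sub_comm,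
    ← eLpNorm_trim (ℱ.le k) (hsm.sub (@SimpleFunc.stronglyMeasurable _ _ (ℱ k) _ g))]
  exact hg.le

/-- Half of δ pays for the adapted simple approximation and half for the centering. The latter is
controlled because fibers of the past history lie in ℱ_k, where d_{k+1} has mean zero. -/
theorem exists_centered_approx [IsProbabilityMeasure μ] (hp : 1 ≤ p) (hp' : p ≠ ∞)
    (hd : IsLpMartingaleDifference p μ ℱ d) {δ : ℝ≥0∞} (hδ : δ ≠ 0) :
    ∃ g : ℕ → SimpleFunc Ω X, ∀ k, eLpNorm (d k - ⇑(centered μ g k)) p μ ≤ δ := by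
  choose g hgm hg using hd.exists_simple_approx hp' (ENNReal.half_pos hδ).ne'
  have hi : ∀ i, Integrable (d i) μ := fun i => (hd.memLp i).integrable hp
  refine ⟨g, fun k => ?_⟩
  rw [eLpNorm_sub_comm]
  cases k with
  | zero => exact (hg 0).trans ENNReal.half_le_self
  | succ k =>
    set c : Ω → X := fun ω => fiberAverage μ (history g (k + 1)) (g (k + 1))
      (history g (k + 1) ω) with hc
    have h1 : eLpNorm c p μ ≤ eLpNorm (⇑(g (k + 1)) - d (k + 1)) p μ :=
      eLpNorm_fiberAverage_le hp _ (g (k + 1)).integrable_of_isFiniteMeasure (hi _) fun l =>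
        hd.setIntegral_eq_zero hp k (measurableSet_history_fiber ℱ hgm k l)
    have e : ⇑(centered μ g (k + 1)) - d (k + 1) = (⇑(g (k + 1)) - d (k + 1)) - c := by
      ext ω
      simp only [centered, SimpleFunc.coe_sub, Pi.sub_apply, SimpleFunc.map_apply, hc]
      abel
    have hcm : AEStronglyMeasurable c μ :=
      ((history g (k + 1)).integrable_comp _).aestronglyMeasurable
    rw [e]
    refine (eLpNorm_sub_le ?_ hcm hp).trans ?_
    · exact (g (k + 1)).aestronglyMeasurable.sub (hi _).aestronglyMeasurable
    · exact (add_le_add (hg _) (h1.trans (hg _))).trans (ENNReal.add_halves δ).le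

/-- Earlier partial sums are conditional expectations of the last one, so they vanish with it. This
serves the degenerate case C = ∞. -/
theorem ae_eq_zero [IsProbabilityMeasure μ] (hd : IsLpMartingaleDifference p μ ℱ d) {N : ℕ}
    (h0 : (fun ω => ∑ k ∈ Finset.range (N + 1), d k ω) =ᵐ[μ] 0) {k : ℕ} (hk : k ≤ N) :
    d k =ᵐ[μ] 0 := by
  have h : ∀ j ≤ N, (fun ω => ∑ i ∈ Finset.range (j + 1), d i ω) =ᵐ[μ] 0 := by
    intro j hj
    refine (hd.martingale.condExp_ae_eq hj).symm.trans ?_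
    refine (condExp_congr_ae h0).trans ?_
    rw [condExp_zero]
  cases k with
  | zero => simpa using h 0 hk
  | succ k =>
    filter_upwards [h (k + 1) hk, h k (by omega)] with ω h1 h2
    rw [Finset.sum_range_succ, h2] at h1
    simpa using h1

/-- The martingale transform inequality for multipliers `ε_k` in whose directions the function
`‖b‖^p - C^p ‖a‖^p` has a concave majorant. -/
theorem eLpNorm_transform_le [IsProbabilityMeasure μ] (hp : 1 ≤ p) (hp' : p ≠ ∞)
    (hd : IsLpMartingaleDifference p μ ℱ d) {C : ℝ≥0∞} (hC : C ≠ ∞) {ε : ℕ → ℂ}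
    (hε : ∀ k, ‖ε k‖ ≤ 1) {U : X × X → ℝ}
    (hΦ : ∀ y, powerDefect p.toReal (C.toReal ^ p.toReal) y ≤ U y)
    (hU : ∀ k y, ConcaveOn ℝ Set.univ fun x => U (y + (x, ε k • x)))
    (hU0 : ∀ k x, U (x, ε k • x) ≤ 0) (N : ℕ) :
    eLpNorm (fun ω => ∑ k ∈ Finset.range N, ε k • d k ω) p μ
      ≤ C * eLpNorm (fun ω => ∑ k ∈ Finset.range N, d k ω) p μ := by
  have hp0 : p ≠ 0 := (zero_lt_one.trans_le hp).ne'
  have hr : 0 < p.toReal := ENNReal.toReal_pos hp0 hp'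
  rcases N with _ | N
  · simp
  have hsimple : ∀ g : ℕ → SimpleFunc Ω X,
      eLpNorm (fun ω => ∑ k ∈ Finset.range (N + 1), ε k • centered μ g k ω) p μ
        ≤ C * eLpNorm (fun ω => ∑ k ∈ Finset.range (N + 1), centered μ g k ω) p μ := by
    intro g
    obtain ⟨P, hP⟩ := exists_sum_centered_eq (μ := μ) g ε (N + 1)
    -- Burkholder's argument: the integrand is at most U, whose mean along the transformed sequence
    -- is nonpositive.
    have h1 : ∫ ω, powerDefect p.toReal (C.toReal ^ p.toReal)
        (∑ i ∈ Finset.range (N + 1), centered μ g i ω,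
          ∑ i ∈ Finset.range (N + 1), ε i • centered μ g i ω) ∂μ ≤ 0 := by
      refine le_trans (integral_mono ?_ ?_ fun ω => hΦ _)
        (integral_centered_le_zero g hU hU0 N)
      · simp only [hP]
        exact (history g (N + 1)).integrable_comp fun l => powerDefect _ _ (P l)
      · simp only [hP]
        exact (history g (N + 1)).integrable_comp fun l => U (P l)
    have hm : ∀ k, MemLp (centered μ g k) p μ := fun k =>
      (centered μ g k).memLp_of_isFiniteMeasure p μ
    have m1 : MemLp (fun ω => ∑ k ∈ Finset.range (N + 1), centered μ g k ω) p μ :=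
      memLp_finsetSum _ fun k _ => hm k
    have m2 : MemLp (fun ω => ∑ k ∈ Finset.range (N + 1), ε k • centered μ g k ω) p μ :=
      memLp_finsetSum _ fun k _ => (hm k).const_smul (ε k)
    simp only [powerDefect] at h1
    rw [integral_sub (m2.integrable_norm_rpow hp0 hp')
      ((m1.integrable_norm_rpow hp0 hp').const_mul _), integral_const_mul, sub_nonpos] at h1
    rw [m1.eLpNorm_eq_integral_rpow_norm hp0 hp', m2.eLpNorm_eq_integral_rpow_norm hp0 hp',
      ← ENNReal.ofReal_toReal hC, ← ENNReal.ofReal_mul ENNReal.toReal_nonneg]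
    refine ENNReal.ofReal_le_ofReal ?_
    have n1 : 0 ≤ ∫ ω, ‖∑ k ∈ Finset.range (N + 1), centered μ g k ω‖ ^ p.toReal ∂μ :=
      integral_nonneg fun _ => by positivity
    have n2 : 0 ≤ ∫ ω, ‖∑ k ∈ Finset.range (N + 1), ε k • centered μ g k ω‖ ^ p.toReal ∂μ :=
      integral_nonneg fun _ => by positivity
    refine (Real.rpow_le_rpow n2 h1 (by positivity)).trans_eq ?_
    rw [Real.mul_rpow (by positivity) n1, Real.rpow_rpow_inv ENNReal.toReal_nonneg hr.ne']
  refine ENNReal.le_of_forall_pos_le_add fun η hη _ => ?_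
  -- N + 1 terms, each approximated within δ, with weight C on the right and 1 on the left: total
  -- error η.
  set δ : ℝ≥0∞ := η / ((C + 1) * (N + 1 : ℕ)) with hδ
  have hden0 : (C + 1) * (N + 1 : ℕ) ≠ 0 := by simp
  have hden : (C + 1) * (N + 1 : ℕ) ≠ ∞ := by
    refine ENNReal.mul_ne_top (by simp [hC]) (ENNReal.natCast_ne_top _)
  have hδ0 : δ ≠ 0 := (ENNReal.div_pos (by exact_mod_cast hη.ne') hden).ne'
  obtain ⟨g, hg⟩ := hd.exists_centered_approx hp hp' hδ0
  have hsm : ∀ k, AEStronglyMeasurable (d k) μ := fun k => (hd.memLp k).1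
  have hcm : ∀ k, AEStronglyMeasurable (centered μ g k) μ := fun k =>
    (centered μ g k).aestronglyMeasurable
  have hdiff : ∀ a : ℕ → ℂ, (∀ k, ‖a k‖ ≤ 1) →
      eLpNorm (∑ k ∈ Finset.range (N + 1), a k • (d k - ⇑(centered μ g k))) p μ
        ≤ (N + 1 : ℕ) * δ := by
    intro a ha
    refine (eLpNorm_sum_le (fun k _ => ((hsm k).sub (hcm k)).const_smul (a k)) hp).trans ?_
    refine (Finset.sum_le_card_nsmul _ _ δ fun k _ => ?_).trans_eq (by simp)
    rw [eLpNorm_const_smul]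
    have h1 : ‖a k‖ₑ ≤ 1 := by
      rw [← ofReal_norm]
      exact ENNReal.ofReal_le_one.2 (ha k)
    calc ‖a k‖ₑ * eLpNorm (d k - ⇑(centered μ g k)) p μ ≤ 1 * δ := by
          gcongr
          exact hg k
      _ = δ := one_mul δ
  have a1 : AEStronglyMeasurable (fun ω => ∑ k ∈ Finset.range (N + 1), centered μ g k ω) μ :=
    Finset.aestronglyMeasurable_fun_sum _ fun k _ => hcm k
  have a2 : AEStronglyMeasurable
      (fun ω => ∑ k ∈ Finset.range (N + 1), ε k • centered μ g k ω) μ :=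
    Finset.aestronglyMeasurable_fun_sum _ fun k _ => (hcm k).const_smul (ε k)
  have a3 : AEStronglyMeasurable (fun ω => ∑ k ∈ Finset.range (N + 1), d k ω) μ :=
    Finset.aestronglyMeasurable_fun_sum _ fun k _ => hsm k
  have a4 : ∀ a : ℕ → ℂ, AEStronglyMeasurable
      (∑ k ∈ Finset.range (N + 1), a k • (d k - ⇑(centered μ g k))) μ := fun a =>
    Finset.aestronglyMeasurable_sum _ fun k _ => ((hsm k).sub (hcm k)).const_smul (a k)
  have e1 : (fun ω => ∑ k ∈ Finset.range (N + 1), ε k • d k ω)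
      = (fun ω => ∑ k ∈ Finset.range (N + 1), ε k • centered μ g k ω)
        + ∑ k ∈ Finset.range (N + 1), ε k • (d k - ⇑(centered μ g k)) := by
    ext ω
    simp [Finset.sum_apply, smul_sub]
  have e2 : (fun ω => ∑ k ∈ Finset.range (N + 1), centered μ g k ω)
      = (fun ω => ∑ k ∈ Finset.range (N + 1), d k ω)
        - ∑ k ∈ Finset.range (N + 1), (1 : ℂ) • (d k - ⇑(centered μ g k)) := by
    ext ω
    simp [Finset.sum_apply]
  have b1 := hdiff ε hε
  have b2 := hdiff (fun _ => 1) (fun _ => by simp)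
  calc eLpNorm (fun ω => ∑ k ∈ Finset.range (N + 1), ε k • d k ω) p μ
      ≤ C * eLpNorm (fun ω => ∑ k ∈ Finset.range (N + 1), centered μ g k ω) p μ
        + (N + 1 : ℕ) * δ := by
        rw [e1]
        exact (eLpNorm_add_le a2 (a4 ε) hp).trans (add_le_add (hsimple g) b1)
    _ ≤ C * (eLpNorm (fun ω => ∑ k ∈ Finset.range (N + 1), d k ω) p μ + (N + 1 : ℕ) * δ)
        + (N + 1 : ℕ) * δ := by
        gcongr
        rw [e2]
        exact (eLpNorm_sub_le a3 (a4 _) hp).trans (add_le_add le_rfl b2)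
    _ = C * eLpNorm (fun ω => ∑ k ∈ Finset.range (N + 1), d k ω) p μ
        + (C + 1) * (N + 1 : ℕ) * δ := by ring
    _ = _ := by rw [hδ, ENNReal.mul_div_cancel hden0 hden]

end IsLpMartingaleDifference

end Approximation
/-! ### From a dense set of multipliers on the circle to the closed disc -/

section Multipliers

theorem norm_circleQuotient (m : ℤ) {n : ℕ} (hn : n ≠ 0) : ‖circleQuotient m n‖ = 1 := by
  have h : (starRingEnd ℂ) (m + n * Complex.I) = m - n * Complex.I := by
    simp [sub_eq_add_neg]
  rw [circleQuotient, norm_div, ← h, Complex.norm_conj,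
    div_self (norm_ne_zero_iff.2 (add_mul_I_ne_zero m hn))]

/-- The closed unit disc is the closed convex hull of the quotients `(m - n i) / (m + n i)`. -/
theorem closedBall_subset_of_circleQuotient_mem {K : Set ℂ} (hK : IsClosed K) (hc : Convex ℝ K)
    (h : ∀ (m : ℤ) (n : ℕ), n ≠ 0 → circleQuotient m n ∈ K) : Metric.closedBall 0 1 ⊆ K := by
  have hq0 : ∀ q : ℝ, (q + Complex.I : ℂ) ≠ 0 := by
    intro q hq
    have := congrArg Complex.im hq
    simp at this
  have hreal : ∀ q : ℝ, (q - Complex.I : ℂ) / (q + Complex.I) ∈ K := by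
    intro q
    -- With q = m/n the quotients are rational values of the Cayley transform; density and
    -- closedness give all real q.
    refine Rat.denseRange_cast.induction_on (p := fun q : ℝ => (q - Complex.I : ℂ) / (q + Complex.I)
      ∈ K) q (hK.preimage ?_) fun a => ?_
    · exact Continuous.div (by fun_prop) (by fun_prop) hq0
    · convert h a.num a.den a.den_nz using 1
      have hd : (a.den : ℂ) ≠ 0 := by exact_mod_cast a.den_nz
      have ha : ((a : ℝ) : ℂ) = a.num / a.den := by
        rw [Complex.ofReal_ratCast]
        exact Rat.cast_def a
      rw [ha, circleQuotient, ← mul_div_mul_right _ _ hd]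
      congr 1 <;> field_simp
  -- The one point of the circle missed by the Cayley transform is its limit as q → ∞.
  have hone : (1 : ℂ) ∈ K := by
    have hlim : Tendsto (fun q : ℕ => (((q : ℝ) : ℂ) - Complex.I) / ((q : ℝ) + Complex.I)) atTop
        (𝓝 1) := by
      rw [tendsto_iff_norm_sub_tendsto_zero]
      refine squeeze_zero' (Eventually.of_forall fun _ => norm_nonneg _) ?_
        (tendsto_const_div_atTop_nhds_zero_nat 2)
      filter_upwards [eventually_gt_atTop 0] with q hq
      have e : (((q : ℝ) : ℂ) - Complex.I) / ((q : ℝ) + Complex.I) - 1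
          = (-2 * Complex.I) / ((q : ℝ) + Complex.I) := by
        rw [div_sub_one (hq0 q)]
        congr 1
        ring
      have hre := Complex.abs_re_le_norm (((q : ℝ) : ℂ) + Complex.I)
      have hq' : (0 : ℝ) < q := by exact_mod_cast hq
      simp only [Complex.add_re, Complex.ofReal_re, Complex.I_re, add_zero, abs_of_pos hq'] at hre
      rw [e, norm_div, norm_mul, Complex.norm_I, mul_one, norm_neg, Complex.norm_ofNat]
      gcongr
    exact hK.mem_of_tendsto hlim (Eventually.of_forall fun q => hreal q)
  rw [← convexHull_sphere_eq_closedBall (0 : ℂ) zero_le_one]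
  refine convexHull_min (fun ε hε => ?_) hc
  by_cases h1 : ε = 1
  · rwa [h1]
  have hnorm : ε.re * ε.re + ε.im * ε.im = 1 := by
    have h2 : ‖ε‖ = 1 := by simpa using hε
    rw [← Complex.normSq_apply, Complex.normSq_eq_norm_sq, h2, one_pow]
  have hre : 1 - ε.re ≠ 0 := by
    intro h2
    have h3 : ε.re = 1 := by linarith
    have h4 : ε.im = 0 := by
      rw [h3] at hnorm
      nlinarith
    exact h1 (Complex.ext h3 h4)
  -- The inverse Cayley transform i(1 + ε)/(1 - ε), which is real for |ε| = 1.
  convert hreal (-ε.im / (1 - ε.re)) using 1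
  rw [eq_div_iff (hq0 _)]
  have hre' : (1 - ε.re : ℂ) ≠ 0 := by exact_mod_cast hre
  have hnorm' : (ε.re : ℂ) * ε.re + ε.im * ε.im = 1 := by exact_mod_cast hnorm
  have key : ∀ a b : ℂ, 1 - a ≠ 0 → a * a + b * b = 1 →
      (a + b * Complex.I) * (-b / (1 - a) + Complex.I) = -b / (1 - a) - Complex.I := by
    intro a b ha hab
    field_simp
    linear_combination b * (1 - a) * Complex.I_sq - Complex.I * hab
  have h := key ε.re ε.im hre' hnorm'
  rw [Complex.re_add_im] at h
  push_cast
  exact h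

variable {Ω : Type v} {mΩ : MeasurableSpace Ω} {μ : Measure Ω}
  {X : Type u} [NormedAddCommGroup X] [NormedSpace ℂ X]

/-- Changing t to s costs at most |t - s|‖d‖_p by the triangle inequality; this needs no
integrability of a. -/
theorem isClosed_setOf_eLpNorm_add_smul_le {p : ℝ≥0∞} (hp : 1 ≤ p) {a d : Ω → X}
    (ha : AEStronglyMeasurable a μ) (hd : MemLp d p μ) (B : ℝ≥0∞) :
    IsClosed {t : ℂ | eLpNorm (a + t • d) p μ ≤ B} := by
  refine isClosed_of_closure_subset fun t ht => ?_
  refine ENNReal.le_of_forall_pos_le_add fun η hη _ => ?_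
  set M : ℝ := (eLpNorm d p μ).toReal with hM
  have hM0 : 0 ≤ M := ENNReal.toReal_nonneg
  have hη' : (0 : ℝ) < η := hη
  obtain ⟨s, hs, hst⟩ := Metric.mem_closure_iff.1 ht (η / (M + 1)) (by positivity)
  have e : a + t • d = (a + s • d) + (t - s) • d := by
    rw [add_assoc, ← add_smul, add_sub_cancel]
  rw [e]
  refine (eLpNorm_add_le (ha.add (hd.1.const_smul s)) (hd.1.const_smul _) hp).trans
    (add_le_add hs ?_)
  rw [eLpNorm_const_smul, ← ENNReal.ofReal_toReal hd.2.ne, ← hM, ← ofReal_norm,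
    ← ENNReal.ofReal_mul (norm_nonneg _), ← ENNReal.ofReal_coe_nnreal]
  refine ENNReal.ofReal_le_ofReal ?_
  rw [dist_eq_norm] at hst
  calc ‖t - s‖ * M ≤ η / (M + 1) * (M + 1) := by
        gcongr
        linarith
    _ = η := by field_simp

theorem convex_setOf_eLpNorm_add_smul_le {p : ℝ≥0∞} (hp : 1 ≤ p) {a d : Ω → X}
    (ha : AEStronglyMeasurable a μ) (hd : MemLp d p μ) (B : ℝ≥0∞) :
    Convex ℝ {t : ℂ | eLpNorm (a + t • d) p μ ≤ B} := by
  intro s hs t ht α β hα hβ hαβ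
  have hm : ∀ t : ℂ, AEStronglyMeasurable (a + t • d) μ := fun t => ha.add (hd.1.const_smul t)
  have e : a + (α • s + β • t) • d = (α : ℂ) • (a + s • d) + (β : ℂ) • (a + t • d) := by
    have h1 : (α : ℂ) + β = 1 := by exact_mod_cast hαβ
    have h2 : a = ((α : ℂ) + β) • a := by rw [h1, one_smul]
    conv_lhs => rw [h2]
    rw [Complex.real_smul, Complex.real_smul]
    module
  have hn : ∀ c : ℝ, 0 ≤ c → ‖(c : ℂ)‖ₑ = ENNReal.ofReal c := by
    intro c hc
    rw [← ofReal_norm, Complex.norm_of_nonneg hc]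
  change eLpNorm _ p μ ≤ B
  rw [e]
  refine (eLpNorm_add_le ((hm s).const_smul _) ((hm t).const_smul _) hp).trans ?_
  rw [eLpNorm_const_smul, eLpNorm_const_smul, hn α hα, hn β hβ]
  calc ENNReal.ofReal α * eLpNorm (a + s • d) p μ + ENNReal.ofReal β * eLpNorm (a + t • d) p μ
      ≤ ENNReal.ofReal α * B + ENNReal.ofReal β * B := by
        gcongr
        · exact hs
        · exact ht
    _ = B := by rw [← add_mul, ← ENNReal.ofReal_add hα hβ, hαβ, ENNReal.ofReal_one, one_mul]

/-- A bound for linear combinations with coefficients `(m - n i) / (m + n i)` extends to all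
coefficients in the closed unit disc. -/
theorem eLpNorm_sum_smul_le_of_circleQuotient {p : ℝ≥0∞} (hp : 1 ≤ p) {d : ℕ → Ω → X}
    (hd : ∀ k, MemLp (d k) p μ) {N : ℕ} {B : ℝ≥0∞}
    (h : ∀ (m : ℕ → ℤ) (n : ℕ → ℕ), (∀ k, n k ≠ 0) →
      eLpNorm (fun ω => ∑ k ∈ Finset.range N, circleQuotient (m k) (n k) • d k ω) p μ ≤ B)
    {ε : ℕ → ℂ} (hε : ∀ k, ε k ∈ Metric.closedBall (0 : ℂ) 1) :
    eLpNorm (fun ω => ∑ k ∈ Finset.range N, ε k • d k ω) p μ ≤ B := by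
  -- Coefficients are released into the disc one at a time: with the others frozen, the admissible
  -- values of one form a closed convex set containing all quotients.
  have key : ∀ j ≤ N, ∀ ε : ℕ → ℂ, (∀ k < j, ε k ∈ Metric.closedBall (0 : ℂ) 1) →
      (∀ k, j ≤ k → ∃ (m : ℤ) (n : ℕ), n ≠ 0 ∧ ε k = circleQuotient m n) →
      eLpNorm (fun ω => ∑ k ∈ Finset.range N, ε k • d k ω) p μ ≤ B := by
    intro j
    induction j with
    | zero =>
      intro _ ε _ h2
      choose m n hn he using fun k => h2 k (Nat.zero_le k)
      simp only [he]
      exact h m n hn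
    | succ j ih =>
      intro hj ε h1 h2
      let a : Ω → X := fun ω => ∑ k ∈ (Finset.range N).erase j, ε k • d k ω
      have ha : AEStronglyMeasurable a μ :=
        Finset.aestronglyMeasurable_fun_sum _ fun k _ => (hd k).1.const_smul (ε k)
      have hjN : j ∈ Finset.range N := Finset.mem_range.2 hj
      have e : ∀ t : ℂ, a + t • d j
          = fun ω => ∑ k ∈ Finset.range N, Function.update ε j t k • d k ω := by
        intro t
        ext ω
        rw [← Finset.sum_erase_add _ _ hjN, Function.update_self]
        simp only [Pi.add_apply, Pi.smul_apply, a]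
        congr 1
        refine Finset.sum_congr rfl fun k hk => ?_
        rw [Function.update_of_ne (Finset.ne_of_mem_erase hk)]
      have hsub := closedBall_subset_of_circleQuotient_mem
        (isClosed_setOf_eLpNorm_add_smul_le hp ha (hd j) B)
        (convex_setOf_eLpNorm_add_smul_le hp ha (hd j) B) (fun m n hn => by
          change eLpNorm _ p μ ≤ B
          rw [e]
          refine ih (by omega) _ (fun k hk => ?_) fun k hk => ?_
          · rw [Function.update_of_ne hk.ne]
            exact h1 k (by omega)
          · by_cases hkj : k = j
            · exact ⟨m, n, hn, by rw [hkj, Function.update_self]⟩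
            · rw [Function.update_of_ne hkj]
              exact h2 k (by omega))
      have := hsub (h1 j (by omega))
      change eLpNorm _ p μ ≤ B at this
      rwa [e, Function.update_eq_self] at this
  -- Coefficients from N on do not enter the sum; they are reset to a quotient to meet the
  -- hypothesis of `key`.
  let ε' : ℕ → ℂ := fun k => if k < N then ε k else circleQuotient 0 1
  have h' := key N le_rfl ε' (fun k hk => by simp only [ε', if_pos hk, hε k])
    (fun k hk => ⟨0, 1, one_ne_zero, by simp only [ε', if_neg (not_lt.2 hk)]⟩)
  have e : (fun ω => ∑ k ∈ Finset.range N, ε k • d k ω)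
      = fun ω => ∑ k ∈ Finset.range N, ε' k • d k ω := by
    ext ω
    refine Finset.sum_congr rfl fun k hk => ?_
    simp only [ε', if_pos (Finset.mem_range.1 hk)]
  rwa [e]

end Multipliers

/-! ### Conclusion -/

theorem corollary4p7 (X : Type u) [NormedAddCommGroup X] [NormedSpace ℂ X] [CompleteSpace X]
    (p : ℝ≥0∞) (hp : 1 < p) (hp' : p < ∞) :
    umdConst.{u, v} (Metric.closedBall (0 : ℂ) 1) p X ≤ beurlingAhlforsNorm p X := by
  refine le_sInf fun C hC => sInf_le ?_
  intro Ω mΩ μ hμ ℱ d ε N hd hε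
  -- The case C = ∞ is not vacuous, since ∞ · 0 = 0: a vanishing sum must force a vanishing
  -- transform.
  by_cases hC' : C = ∞
  · subst hC'
    by_cases h0 : eLpNorm (fun ω => ∑ n ∈ Finset.range N, d n ω) p μ = 0
    · rcases N with _ | N
      · simp
      have hsm : ∀ k, AEStronglyMeasurable (d k) μ := fun k => (hd.memLp k).1
      rw [eLpNorm_eq_zero_iff (Finset.aestronglyMeasurable_fun_sum _ fun k _ => hsm k)
        (zero_lt_one.trans hp).ne'] at h0
      have h1 : (fun ω => ∑ n ∈ Finset.range (N + 1), ε n • d n ω) =ᵐ[μ] 0 := by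
        have h2 : ∀ᵐ ω ∂μ, ∀ k ∈ Finset.range (N + 1), d k ω = 0 :=
          (Finset.eventually_all _).2 fun k hk =>
            hd.ae_eq_zero h0 (Nat.lt_succ_iff.1 (Finset.mem_range.1 hk))
        filter_upwards [h2] with ω hω
        exact Finset.sum_eq_zero fun k hk => by rw [hω k hk, smul_zero]
      rw [eLpNorm_congr_ae h1]
      simp
    · rw [ENNReal.top_mul h0]
      exact le_top
  have hp0 : p ≠ 0 := (zero_lt_one.trans hp).ne'
  have hr : 0 < p.toReal := ENNReal.toReal_pos hp0 hp'.ne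
  have hK : 0 ≤ C.toReal ^ p.toReal := by positivity
  have hΦ := continuous_powerDefect (X := X) hr (C.toReal ^ p.toReal)
  -- The energy at the origin is ‖∂g‖_p^p - C^p‖∂̄g‖_p^p over a period.
  have hE : ∀ g : ℂ → X, IsPeriodicField g →
      fieldEnergy (powerDefect p.toReal (C.toReal ^ p.toReal)) 0 g ≤ 0 := by
    intro g hg
    have h := hg.integral_norm_wirtinger_rpow_le hr hK fun G h1 h2 h3 =>
      integral_norm_wirtinger_rpow_le hp hp' hC' hC h1 h2 h3
    simp only [fieldEnergy, powerDefect, zero_add, wirtingerPair]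
    rw [integral_sub
      (hg.continuous_wirtinger.norm.rpow_const fun _ => Or.inr hr.le).integrable_squareMeasure
      ((hg.continuous_bar.norm.rpow_const fun _ => Or.inr hr.le).integrable_squareMeasure.const_mul
        _), integral_const_mul, sub_nonpos]
    exact h
  obtain ⟨U, hU1, hU2, hU3⟩ := exists_concave_majorant hΦ (fun y => by simp [powerDefect]) hE
  refine eLpNorm_sum_smul_le_of_circleQuotient hp.le hd.memLp (fun m n hn => ?_) hε
  exact hd.eLpNorm_transform_le hp.le hp'.ne hC' (fun k => (norm_circleQuotient (m k) (hn k)).le)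
    hU1 (fun k => hU2 (m k) (n k) (hn k)) (fun k => hU3 (m k) (n k) (hn k)) N
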